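/- **Setting.** Let $d\ge 1$ and let $\Omega\subset\mathbb R^d$ be a bounded Lipschitz domain. Let $A\in C^{0,1}(\overline\Omega)$ take values in the symmetric $d\times d$ matrices with $a_0|v|^2\le v^{T}A(x)v\le a_1|v|^2$ for all $x\in\overline\Omega$, $v\in\mathbb R^d$ and some constants $a_0,a_1>0$; let $0\le c\in C^{0,1}(\overline\Omega)$; let $\beta\in C^1(\overline\Omega;\mathbb R^d)$ satisfy $\operatorname{div}\beta=0$ in $\Omega$; let $\chi\in C^2(\overline\Omega)$ satisfy $\chi<0$ on $\partial\Omega$. Let $s\in(0,1)$ and $\iota\in\{0,1\}$, in one of the following cases: $\iota=0$ and $\beta=0$; or $\iota=0$, $\beta\ne0$ and $s\ge\frac12$; or $\iota=1$. A function $w$ on $\Omega$ is identified with its extension by zero to $\mathbb R^d$, and $\mathcal F$ is the unitary Fourier transform. Put $a_s(v,w)=\int_{\mathbb R^d}|\xi|^{2s}\mathcal F(v)(\xi)\overline{\mathcal F(w)(\xi)}\,d\xi$ and $\widetilde H^s(\Omega)=\{w\in L^2(\Omega): a_s(w,w)<\infty\}$. Let $H^1_0(\Omega)$ be the closure of $C_0^\infty(\Omega)$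 in $H^1(\Omega)$. Set $$V=\widetilde H^s(\Omega)\ \text{ if }\iota=0,\qquad V=H^1_0(\Omega)\ \text{ if }\iota=1,\qquad \|w\|_V^2=\|w\|_{L^2(\Omega)}^2+a_s(w,w)+\iota\|\nabla w\|_{L^2(\Omega)}^2,$$ and let $V'$ be the dual of $V$. For $v,w\in V$ let $$\mathcal A(v,w)=\iota\int_\Omega\big(\nabla w^{T}A\nabla v+c\,v\,w\big)\,dx+\mathcal D(v,w)+a_s(v,w),$$ where $\mathcal D$ is the continuous extension to $V\times V$ of the bilinear form $(\varphi,\psi)\mapsto\int_\Omega(\beta\cdot\nabla\varphi)\,\psi\,dx$ on $C_0^\infty(\Omega)\times C_0^\infty(\Omega)$. Let $\mathcal K=\{w\in V: w\ge\chi\text{ a.e. in }\Omega\}$. **Theorem (complementarity conditions).** Let $f\in V'$ and let $u\in\mathcal K$ solve the variational inequality $$\mathcal A(u,u-v)\le\langle f,u-v\rangle_{V',V}\qquad\text{for all }v\in\mathcal K.$$ Then $\langle\Lambda,w\rangle=\mathcal A(u,w)-\langle f,w\rangle$, $w\in V$, defines an element $\Lambda\in V'$ (that is, $\Lambda=\iota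 Lu+\beta\cdot\nabla u+(-\Delta)^su-f$ with $Lu=-\operatorname{div}(A\nabla u)+cu$), and $\Lambda\ge0$ in $V'$: $\langle\Lambda,w\rangle\ge0$ for every $w\in V$ with $w\ge0$ a.e. in $\Omega$. If in addition $u\in C(\overline\Omega)$, that is, $u$ agrees a.e. in $\Omega$ with a function $g$ that is continuous on $\overline\Omega$, then $$\Lambda\ge0,\qquad u\ge\chi,\qquad\Lambda(u-\chi)=0$$ in the sense of distributions in $\Omega$: 1. $\langle\Lambda,\varphi\rangle\ge0$ for every $0\le\varphi\in C_0^\infty(\Omega)$; 2. $\int_\Omega(g-\chi)\varphi\,dx\ge0$ for every $0\le\varphi\in C_0^\infty(\Omega)$; 3. there is a Borel measure $\mu$ on $\Omega$, finite on compact subsets of $\Omega$, such that $\langle\Lambda,\varphi\rangle=\int_\Omega\varphi\,d\mu$ and $\int_\Omega(g-\chi)\varphi\,d\mu=0$ for every $\varphi\in C_0^\infty(\Omega)$. -/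

import Mathlib

open MeasureTheory Set TopologicalSpace FourierTransform InnerProductSpace
open scoped Distributions ENNReal NNReal

noncomputable section

namespace FracObstacle

/-- Euclidean space `ℝ^d`. -/
abbrev E (d : ℕ) : Type := EuclideanSpace ℝ (Fin d)

/-- The space `L²(ℝ^d)` of real functions. A function on `Ω` is identified with its extension by
zero, so `L²(Ω)` is the set of those elements that vanish almost everywhere off `Ω`. -/
abbrev L2 (d : ℕ) : Type := Lp ℝ 2 (volume : Measure (E d))

variable {d : ℕ}

/-! ### Domains and classical regularity up to the boundary -/

/-- Bounded Lipschitz domain: a bounded, connected, nonempty open set whose boundary is locally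
the graph of a Lipschitz function, with the set lying on one side of the graph. -/
structure IsBoundedLipschitzDomain (Ω : Opens (E d)) : Prop where
  bounded : Bornology.IsBounded (Ω : Set (E d))
  connected : IsConnected (Ω : Set (E d))
  lipschitz : ∀ x₀ ∈ frontier (Ω : Set (E d)), ∃ ν : E d, ‖ν‖ = 1 ∧ ∃ r : ℝ, 0 < r ∧
    ∃ (K : ℝ≥0) (γ : (ℝ ∙ ν)ᗮ → ℝ), LipschitzWith K γ ∧
      ∀ y ∈ Metric.ball x₀ r, y ∈ Ω ↔ γ ((ℝ ∙ ν)ᗮ.orthogonalProjectionOnto y) < ⟪ν, y⟫_ℝ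

/-- `g ∈ C^k(closure Ω)`: `g` is continuous on the closure, `C^k` in `Ω`, and its derivatives up
to order `k` extend continuously to the closure. -/
def IsCkOnClosure {F : Type*} [NormedAddCommGroup F] [NormedSpace ℝ F]
    (k : ℕ) (Ω : Opens (E d)) (g : E d → F) : Prop :=
  ContinuousOn g (closure (Ω : Set (E d))) ∧ ContDiffOn ℝ k g Ω ∧
    ∀ m ≤ k, ∃ G : E d → (E d [×m]→L[ℝ] F),
      ContinuousOn G (closure (Ω : Set (E d))) ∧ EqOn G (iteratedFDeriv ℝ m g) Ω

/-- `A ∈ C^{0,1}(closure Ω)` with values in the symmetric matrices, bounded and uniformly positive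
definite. -/
def IsEllipticCoefficient (Ω : Opens (E d)) (A : E d → Matrix (Fin d) (Fin d) ℝ) : Prop :=
  (∀ i j, ∃ K : ℝ≥0, LipschitzOnWith K (fun x => A x i j) (closure (Ω : Set (E d)))) ∧
  (∀ x ∈ closure (Ω : Set (E d)), (A x).IsSymm) ∧
  ∃ a₀ a₁ : ℝ, 0 < a₀ ∧ 0 < a₁ ∧ ∀ x ∈ closure (Ω : Set (E d)), ∀ v : E d,
    a₀ * ‖v‖ ^ 2 ≤ ⟪v, (A x).toEuclideanLin v⟫_ℝ ∧
      ⟪v, (A x).toEuclideanLin v⟫_ℝ ≤ a₁ * ‖v‖ ^ 2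

/-- `c ∈ C^{0,1}(closure Ω)` is nonnegative. -/
def IsReactionCoefficient (Ω : Opens (E d)) (c : E d → ℝ) : Prop :=
  (∃ K : ℝ≥0, LipschitzOnWith K c (closure (Ω : Set (E d)))) ∧
    ∀ x ∈ closure (Ω : Set (E d)), 0 ≤ c x

/-- `β ∈ C^1(closure Ω)` is solenoidal in `Ω`. -/
def IsDriftCoefficient (Ω : Opens (E d)) (β : E d → E d) : Prop :=
  IsCkOnClosure 1 Ω β ∧
    ∀ x ∈ Ω, ∑ i : Fin d, (fderiv ℝ β x (EuclideanSpace.single i 1)) i = 0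

/-- The three cases, for `0 < s < 1`: purely fractional diffusion, fractional diffusion with drift,
and integro-differential operator. -/
def IsAdmissibleCase (Ω : Opens (E d)) (β : E d → E d) (s : ℝ) (ι : Fin 2) : Prop :=
  (ι = 0 ∧ ∀ x ∈ Ω, β x = 0) ∨ (ι = 0 ∧ (∃ x ∈ Ω, β x ≠ 0) ∧ 1 / 2 ≤ s) ∨ ι = 1

/-- The obstacle is in `C^2(closure Ω)` and negative on the boundary. -/
def IsObstacle (Ω : Opens (E d)) (χ : E d → ℝ) : Prop :=
  IsCkOnClosure 2 Ω χ ∧ ∀ x ∈ frontier (Ω : Set (E d)), χ x < 0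

/-! ### Fractional Sobolev space and the fractional Laplacian -/

/-- A real `L²` function as a complex one. -/
def toC (u : L2 d) : Lp ℂ 2 (volume : Measure (E d)) :=
  Complex.ofRealCLM.compLpL 2 volume u

/-- The `L²` Fourier transform, normalised as `∫ exp(-2πi x·ξ) u(x) dx` for integrable `u`. -/
def fourierL2 (u : L2 d) : Lp ℂ 2 (volume : Measure (E d)) := 𝓕 (toC u)

theorem toC_add (u v : L2 d) : toC (u + v) = toC u + toC v := map_add _ u v

theorem toC_smul (a : ℝ) (u : L2 d) : toC (a • u) = (a : ℂ) • toC u := by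
  have h : toC (a • u) = a • toC u := map_smul (Complex.ofRealCLM.compLpL 2 volume) a u
  rw [h]
  exact (Complex.coe_smul a (toC u)).symm

theorem fourierL2_add (u v : L2 d) : fourierL2 (u + v) = fourierL2 u + fourierL2 v := by
  simp only [fourierL2, toC_add]
  exact (Lp.fourierTransformₗᵢ (E d) ℂ).map_add _ _

theorem fourierL2_smul (a : ℝ) (u : L2 d) : fourierL2 (a • u) = (a : ℂ) • fourierL2 u := by
  simp only [fourierL2, toC_smul]
  exact (Lp.fourierTransformₗᵢ (E d) ℂ).map_smul _ _

/-- The space of `u ∈ L²(Ω)` whose extension by zero lies in `H^s(ℝ^d)`, that is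
`∫ |ξ|^{2s} |𝓕 u(ξ)|² dξ < ∞`. -/
def tildeH (Ω : Opens (E d)) (s : ℝ) : Submodule ℝ (L2 d) where
  carrier := {u | (∀ᵐ x, x ∉ Ω → u x = 0) ∧
    MemLp (fun ξ : E d => ((‖ξ‖ ^ s : ℝ) : ℂ) * fourierL2 u ξ) 2 volume}
  zero_mem' := by
    have h0 : fourierL2 (0 : L2 d) = 0 := by
      simpa only [zero_smul, Complex.ofReal_zero] using fourierL2_smul (0 : ℝ) (0 : L2 d)
    refine ⟨?_, ?_⟩
    · filter_upwards [Lp.coeFn_zero ℝ 2 (volume : Measure (E d))] with x hx _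
      rw [hx, Pi.zero_apply]
    · rw [h0]
      refine (memLp_congr_ae ?_).2 (MemLp.zero' (ε := ℂ))
      filter_upwards [Lp.coeFn_zero ℂ 2 (volume : Measure (E d))] with x hx
      rw [hx, Pi.zero_apply, mul_zero]
  add_mem' := by
    rintro u v ⟨hu, hu'⟩ ⟨hv, hv'⟩
    refine ⟨?_, ?_⟩
    · filter_upwards [hu, hv, Lp.coeFn_add u v] with x h1 h2 h3 hx
      rw [h3, Pi.add_apply, h1 hx, h2 hx, add_zero]
    · rw [fourierL2_add]
      refine (memLp_congr_ae ?_).2 (hu'.add hv')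
      filter_upwards [Lp.coeFn_add (fourierL2 u) (fourierL2 v)] with x hx
      rw [hx, Pi.add_apply, Pi.add_apply, mul_add]
  smul_mem' := by
    rintro a u ⟨hu, hu'⟩
    refine ⟨?_, ?_⟩
    · filter_upwards [hu, Lp.coeFn_smul a u] with x h1 h3 hx
      rw [h3, Pi.smul_apply, h1 hx, smul_zero]
    · rw [fourierL2_smul]
      refine (memLp_congr_ae ?_).2 (hu'.const_mul (a : ℂ))
      filter_upwards [Lp.coeFn_smul (a : ℂ) (fourierL2 u)] with x hx
      simp only [hx, Pi.smul_apply, smul_eq_mul]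
      ring

/-- The form `a_s(v, w) = ∫ |ξ|^{2s} F(v)(ξ) conj (F(w)(ξ)) dξ` of the fractional Laplacian, with
`F` the unitary Fourier transform in the angular frequency `ξ = 2πη`; in the frequency `η` of
`fourierL2` the symbol `|ξ|^{2s}` is `(2π|η|)^{2s}`. For real `v`, `w` the integral is real. -/
def fracForm (s : ℝ) (v w : L2 d) : ℝ :=
  ∫ η : E d, (2 * Real.pi * ‖η‖) ^ (2 * s) *
    (fourierL2 v η * (starRingEnd ℂ) (fourierL2 w η)).re

/-! ### The Sobolev space with vanishing trace -/

/-- `G ∈ L²(Ω)^d` is the weak gradient of `u` in `Ω`. -/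
def HasWeakGradient (Ω : Opens (E d)) (u : L2 d) (G : E d → E d) : Prop :=
  MemLp G 2 (volume.restrict (Ω : Set (E d))) ∧
    ∀ (φ : 𝓓(Ω, ℝ)) (i : Fin d),
      ∫ x in (Ω : Set (E d)), u x * (gradient φ x) i = -∫ x in (Ω : Set (E d)), G x i * φ x

open scoped Classical in
/-- The weak gradient of `u` in `Ω` (zero if there is none). -/
def weakGradient (Ω : Opens (E d)) (u : L2 d) : E d → E d :=
  if h : ∃ G, HasWeakGradient Ω u G then h.choose else 0

theorem gradient_apply (φ : E d → ℝ) (x : E d) (i : Fin d) :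
    (gradient φ x) i = fderiv ℝ φ x (EuclideanSpace.single i 1) := by
  have h : ⟪gradient φ x, EuclideanSpace.single i (1 : ℝ)⟫_ℝ =
      fderiv ℝ φ x (EuclideanSpace.single i 1) := by
    rw [gradient]; exact InnerProductSpace.toDual_symm_apply
  rw [← h, EuclideanSpace.inner_single_right]
  simp

theorem gradient_eq (φ : E d → ℝ) :
    gradient φ = (InnerProductSpace.toDual ℝ (E d)).symm ∘ fderiv ℝ φ := rfl

theorem continuous_gradient {Ω : Opens (E d)} (φ : 𝓓(Ω, ℝ)) : Continuous (gradient φ) := by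
  rw [gradient_eq]
  exact (InnerProductSpace.toDual ℝ (E d)).symm.continuous.comp
    (φ.contDiff.continuous_fderiv (by simp))

theorem hasCompactSupport_gradient {Ω : Opens (E d)} (φ : 𝓓(Ω, ℝ)) :
    HasCompactSupport (gradient φ) := by
  rw [gradient_eq]
  exact (φ.hasCompactSupport.fderiv ℝ).comp_left (map_zero _)

theorem memLp_gradient {Ω : Opens (E d)} (φ : 𝓓(Ω, ℝ)) :
    MemLp (gradient φ) 2 (volume.restrict (Ω : Set (E d))) :=
  (continuous_gradient φ).memLp_of_hasCompactSupport (hasCompactSupport_gradient φ)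

theorem memLp_test {Ω : Opens (E d)} (φ : 𝓓(Ω, ℝ)) (p : ℝ≥0∞) (μ : Measure (E d))
    [IsFiniteMeasureOnCompacts μ] : MemLp φ p μ :=
  φ.continuous.memLp_of_hasCompactSupport φ.hasCompactSupport

theorem memLp_coord {G : E d → E d} {μ : Measure (E d)} (hG : MemLp G 2 μ) (i : Fin d) :
    MemLp (fun x => G x i) 2 μ :=
  (EuclideanSpace.proj i : E d →L[ℝ] ℝ).comp_memLp' hG

theorem HasWeakGradient.add {Ω : Opens (E d)} {u v : L2 d} {G H : E d → E d}
    (hu : HasWeakGradient Ω u G) (hv : HasWeakGradient Ω v H) :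
    HasWeakGradient Ω (u + v) (G + H) := by
  refine ⟨hu.1.add hv.1, fun φ i => ?_⟩
  have hg := memLp_coord (memLp_gradient φ) i
  have hφ := memLp_test φ 2 (volume.restrict (Ω : Set (E d)))
  have e1 : ∫ x in (Ω : Set (E d)), (u + v : L2 d) x * (gradient φ x) i =
      ∫ x in (Ω : Set (E d)), (u x * (gradient φ x) i + v x * (gradient φ x) i) := by
    refine integral_congr_ae ?_
    filter_upwards [ae_restrict_of_ae (Lp.coeFn_add u v)] with x hx
    rw [hx, Pi.add_apply, add_mul]
  have e2 : ∫ x in (Ω : Set (E d)), (G + H) x i * φ x =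
      ∫ x in (Ω : Set (E d)), (G x i * φ x + H x i * φ x) := by
    refine integral_congr_ae (Filter.Eventually.of_forall fun x => ?_)
    simp [add_mul]
  have i1 : IntegrableOn (fun x => u x * (gradient φ x) i) Ω :=
    ((Lp.memLp u).restrict _).integrable_mul hg
  have i2 : IntegrableOn (fun x => v x * (gradient φ x) i) Ω :=
    ((Lp.memLp v).restrict _).integrable_mul hg
  have i3 : IntegrableOn (fun x => G x i * φ x) Ω := (memLp_coord hu.1 i).integrable_mul hφ
  have i4 : IntegrableOn (fun x => H x i * φ x) Ω := (memLp_coord hv.1 i).integrable_mul hφ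
  rw [e1, e2, integral_add i1 i2, integral_add i3 i4, hu.2 φ i, hv.2 φ i, neg_add]

theorem HasWeakGradient.smul {Ω : Opens (E d)} {u : L2 d} {G : E d → E d} (a : ℝ)
    (hu : HasWeakGradient Ω u G) : HasWeakGradient Ω (a • u) (a • G) := by
  refine ⟨hu.1.const_smul a, fun φ i => ?_⟩
  have e1 : ∫ x in (Ω : Set (E d)), (a • u : L2 d) x * (gradient φ x) i =
      ∫ x in (Ω : Set (E d)), a * (u x * (gradient φ x) i) := by
    refine integral_congr_ae ?_
    filter_upwards [ae_restrict_of_ae (Lp.coeFn_smul a u)] with x hx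
    rw [hx, Pi.smul_apply, smul_eq_mul, mul_assoc]
  have e2 : ∫ x in (Ω : Set (E d)), (a • G) x i * φ x =
      ∫ x in (Ω : Set (E d)), a * (G x i * φ x) := by
    refine integral_congr_ae (Filter.Eventually.of_forall fun x => ?_)
    simp [mul_assoc]
  rw [e1, e2, integral_const_mul, integral_const_mul, hu.2 φ i, mul_neg]

/-- A test function as an element of `L²`. -/
def testL2 {Ω : Opens (E d)} (φ : 𝓓(Ω, ℝ)) : L2 d := (memLp_test φ 2 volume).toLp φ

theorem testL2_ae {Ω : Opens (E d)} (φ : 𝓓(Ω, ℝ)) : testL2 φ =ᵐ[volume] φ :=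
  (memLp_test φ 2 volume).coeFn_toLp

theorem test_eq_zero {Ω : Opens (E d)} (φ : 𝓓(Ω, ℝ)) {x : E d} (hx : x ∉ Ω) : φ x = 0 :=
  image_eq_zero_of_notMem_tsupport fun h => hx (φ.tsupport_subset h)

theorem hasWeakGradient_test {Ω : Opens (E d)} (φ : 𝓓(Ω, ℝ)) :
    HasWeakGradient Ω (testL2 φ) (gradient φ) := by
  refine ⟨memLp_gradient φ, fun ψ i => ?_⟩
  have z : ∀ x ∉ (Ω : Set (E d)), gradient ψ x = 0 := fun x hx => by
    have : x ∉ tsupport (fderiv ℝ ψ) := fun h =>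
      hx (ψ.tsupport_subset (tsupport_fderiv_subset ℝ h))
    rw [gradient, image_eq_zero_of_notMem_tsupport this, map_zero]
  have e1 : ∫ x in (Ω : Set (E d)), testL2 φ x * (gradient ψ x) i =
      ∫ x, φ x * fderiv ℝ ψ x (EuclideanSpace.single i 1) := by
    rw [setIntegral_eq_integral_of_forall_compl_eq_zero fun x hx => by simp [z x hx]]
    refine integral_congr_ae ?_
    filter_upwards [testL2_ae φ] with x hx
    rw [hx, gradient_apply]
  have e2 : ∫ x in (Ω : Set (E d)), (gradient φ x) i * ψ x =
      ∫ x, fderiv ℝ φ x (EuclideanSpace.single i 1) * ψ x := by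
    rw [setIntegral_eq_integral_of_forall_compl_eq_zero fun x hx => by
      rw [test_eq_zero ψ hx, mul_zero]]
    simp only [gradient_apply]
  rw [e1, e2]
  have hfd : ∀ θ : 𝓓(Ω, ℝ), Continuous fun x => fderiv ℝ θ x (EuclideanSpace.single i 1) :=
    fun θ => (θ.contDiff.continuous_fderiv (by simp)).clm_apply continuous_const
  refine integral_mul_fderiv_eq_neg_fderiv_mul_of_integrable ?_ ?_ ?_
    (fun x _ => φ.contDiff.differentiable (by simp) x)
    (fun x _ => ψ.contDiff.differentiable (by simp) x)
  · exact ((hfd φ).mul ψ.continuous).integrable_of_hasCompactSupport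
      ψ.hasCompactSupport.mul_left
  · exact (φ.continuous.mul (hfd ψ)).integrable_of_hasCompactSupport
      φ.hasCompactSupport.mul_right
  · exact (φ.continuous.mul ψ.continuous).integrable_of_hasCompactSupport
      φ.hasCompactSupport.mul_right

/-- `u` can be approximated, together with its weak gradient `G`, by test functions. -/
def IsTestLimit (Ω : Opens (E d)) (u : L2 d) (G : E d → E d) : Prop :=
  ∀ ε : ℝ≥0∞, 0 < ε → ∃ φ : 𝓓(Ω, ℝ),
    eLpNorm (fun x => u x - φ x) 2 (volume.restrict (Ω : Set (E d))) ≤ ε ∧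
    eLpNorm (fun x => G x - gradient φ x) 2 (volume.restrict (Ω : Set (E d))) ≤ ε

theorem isTestLimit_test {Ω : Opens (E d)} (φ : 𝓓(Ω, ℝ)) :
    IsTestLimit Ω (testL2 φ) (gradient φ) := by
  intro ε _
  refine ⟨φ, ?_, ?_⟩
  · refine le_of_eq_of_le ?_ (zero_le : 0 ≤ ε)
    refine (eLpNorm_congr_ae ?_).trans (eLpNorm_zero (ε := ℝ))
    filter_upwards [ae_restrict_of_ae (testL2_ae φ)] with x hx
    simp [hx]
  · simp

theorem gradient_add_test {Ω : Opens (E d)} (φ ψ : 𝓓(Ω, ℝ)) (x : E d) :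
    gradient (φ + ψ : 𝓓(Ω, ℝ)) x = gradient φ x + gradient ψ x := by
  have h : fderiv ℝ (φ + ψ : 𝓓(Ω, ℝ)) x = fderiv ℝ φ x + fderiv ℝ ψ x :=
    fderiv_add (φ.contDiff.differentiable (by simp) x) (ψ.contDiff.differentiable (by simp) x)
  rw [gradient, h, map_add]; rfl

theorem gradient_smul_test {Ω : Opens (E d)} (a : ℝ) (φ : 𝓓(Ω, ℝ)) (x : E d) :
    gradient (a • φ : 𝓓(Ω, ℝ)) x = a • gradient φ x := by
  have h : fderiv ℝ (a • φ : 𝓓(Ω, ℝ)) x = a • fderiv ℝ φ x :=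
    fderiv_const_smul (φ.contDiff.differentiable (by simp) x) a
  rw [gradient, h, map_smul]; rfl

theorem IsTestLimit.add {Ω : Opens (E d)} {u v : L2 d} {G H : E d → E d}
    (mG : MemLp G 2 (volume.restrict (Ω : Set (E d))))
    (mH : MemLp H 2 (volume.restrict (Ω : Set (E d))))
    (hu : IsTestLimit Ω u G) (hv : IsTestLimit Ω v H) : IsTestLimit Ω (u + v) (G + H) := by
  intro ε hε
  obtain ⟨φ, h1, h2⟩ := hu (ε / 2) (ENNReal.half_pos hε.ne')
  obtain ⟨ψ, h3, h4⟩ := hv (ε / 2) (ENNReal.half_pos hε.ne')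
  refine ⟨φ + ψ, ?_, ?_⟩
  · have e : (fun x => (u + v : L2 d) x - (φ + ψ : 𝓓(Ω, ℝ)) x)
        =ᵐ[volume.restrict (Ω : Set (E d))]
        ((fun x => u x - φ x) + fun x => v x - ψ x) := by
      filter_upwards [ae_restrict_of_ae (Lp.coeFn_add u v)] with x hx
      rw [hx]
      change u x + v x - (φ x + ψ x) = (u x - φ x) + (v x - ψ x)
      ring
    rw [eLpNorm_congr_ae e]
    refine (eLpNorm_add_le ?_ ?_ (by norm_num)).trans ((add_le_add h1 h3).trans
      (ENNReal.add_halves ε).le)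
    · exact (((Lp.memLp u).restrict _).sub (memLp_test φ 2 _)).1
    · exact (((Lp.memLp v).restrict _).sub (memLp_test ψ 2 _)).1
  · have e : (fun x => (G + H) x - gradient (φ + ψ : 𝓓(Ω, ℝ)) x) =
        ((fun x => G x - gradient φ x) + fun x => H x - gradient ψ x) := by
      funext x
      rw [gradient_add_test, Pi.add_apply, Pi.add_apply]
      abel
    rw [e]
    exact (eLpNorm_add_le (mG.sub (memLp_gradient φ)).1 (mH.sub (memLp_gradient ψ)).1
      (by norm_num)).trans ((add_le_add h2 h4).trans (ENNReal.add_halves ε).le)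

theorem IsTestLimit.smul {Ω : Opens (E d)} {u : L2 d} {G : E d → E d} (a : ℝ)
    (hu : IsTestLimit Ω u G) : IsTestLimit Ω (a • u) (a • G) := by
  intro ε hε
  have hpos : 0 < ε / (‖a‖ₑ + 1) :=
    ENNReal.div_pos hε.ne' (by simp)
  obtain ⟨φ, h1, h2⟩ := hu _ hpos
  have key : ‖a‖ₑ * (ε / (‖a‖ₑ + 1)) ≤ ε := by
    calc ‖a‖ₑ * (ε / (‖a‖ₑ + 1)) ≤ (‖a‖ₑ + 1) * (ε / (‖a‖ₑ + 1)) := by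
          gcongr; exact le_self_add
      _ ≤ ε := ENNReal.mul_div_le
  refine ⟨a • φ, ?_, ?_⟩
  · have e : (fun x => (a • u : L2 d) x - (a • φ : 𝓓(Ω, ℝ)) x)
        =ᵐ[volume.restrict (Ω : Set (E d))] a • fun x => u x - φ x := by
      filter_upwards [ae_restrict_of_ae (Lp.coeFn_smul a u)] with x hx
      rw [hx]
      change a * u x - a * φ x = a * (u x - φ x)
      ring
    rw [eLpNorm_congr_ae e, eLpNorm_const_smul]
    exact (mul_le_mul_right h1 _).trans key
  · have e : (fun x => (a • G) x - gradient (a • φ : 𝓓(Ω, ℝ)) x) =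
        a • fun x => G x - gradient φ x := by
      funext x
      rw [gradient_smul_test, Pi.smul_apply, Pi.smul_apply, smul_sub]
    rw [e, eLpNorm_const_smul]
    exact (mul_le_mul_right h2 _).trans key

/-- `H^1_0(Ω)`: the functions on `Ω` with weak gradient in `L²(Ω)` that are limits in `H^1(Ω)` of
test functions. -/
def H10 (Ω : Opens (E d)) : Submodule ℝ (L2 d) where
  carrier := {u | (∀ᵐ x, x ∉ Ω → u x = 0) ∧ ∃ G, HasWeakGradient Ω u G ∧ IsTestLimit Ω u G}
  zero_mem' := by
    refine ⟨?_, 0 • gradient (0 : 𝓓(Ω, ℝ)), ?_⟩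
    · filter_upwards [Lp.coeFn_zero ℝ 2 (volume : Measure (E d))] with x hx _
      rw [hx, Pi.zero_apply]
    · have h := hasWeakGradient_test (0 : 𝓓(Ω, ℝ))
      have h' := isTestLimit_test (0 : 𝓓(Ω, ℝ))
      have e : (0 : L2 d) = (0 : ℝ) • testL2 (0 : 𝓓(Ω, ℝ)) := (zero_smul _ _).symm
      rw [e]
      have e' : (0 : ℕ) • gradient (0 : 𝓓(Ω, ℝ)) = (0 : ℝ) • gradient (0 : 𝓓(Ω, ℝ)) := by simp
      rw [e']
      exact ⟨h.smul 0, h'.smul 0⟩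
  add_mem' := by
    rintro u v ⟨hu, G, hG, hG'⟩ ⟨hv, H, hH, hH'⟩
    refine ⟨?_, G + H, hG.add hH, hG'.add hG.1 hH.1 hH'⟩
    filter_upwards [hu, hv, Lp.coeFn_add u v] with x h1 h2 h3 hx
    rw [h3, Pi.add_apply, h1 hx, h2 hx, add_zero]
  smul_mem' := by
    rintro a u ⟨hu, G, hG, hG'⟩
    refine ⟨?_, a • G, hG.smul a, hG'.smul a⟩
    filter_upwards [hu, Lp.coeFn_smul a u] with x h1 h3 hx
    rw [h3, Pi.smul_apply, h1 hx, smul_zero]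

theorem testL2_ae_zero {Ω : Opens (E d)} (φ : 𝓓(Ω, ℝ)) : ∀ᵐ x, x ∉ Ω → testL2 φ x = 0 := by
  filter_upwards [testL2_ae φ] with x hx h
  rw [hx, test_eq_zero φ h]

theorem testL2_mem_H10 {Ω : Opens (E d)} (φ : 𝓓(Ω, ℝ)) : testL2 φ ∈ H10 Ω :=
  ⟨testL2_ae_zero φ, gradient φ, hasWeakGradient_test φ, isTestLimit_test φ⟩

theorem testL2_mem_tildeH {Ω : Opens (E d)} (φ : 𝓓(Ω, ℝ)) {s : ℝ} (hs : 0 ≤ s) :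
    testL2 φ ∈ tildeH Ω s := by
  refine ⟨testL2_ae_zero φ, ?_⟩
  have hc : HasCompactSupport (fun x => (φ x : ℂ)) :=
    φ.hasCompactSupport.comp_left (g := fun r : ℝ => (r : ℂ)) Complex.ofReal_zero
  have hd : ContDiff ℝ (⊤ : ℕ∞) (fun x => (φ x : ℂ)) :=
    Complex.ofRealCLM.contDiff.comp φ.contDiff
  let S : SchwartzMap (E d) ℂ := hc.toSchwartzMap hd
  have h1 : toC (testL2 φ) = S.toLp 2 := by
    apply Lp.ext
    filter_upwards [Complex.ofRealCLM.coeFn_compLpL (p := 2) (testL2 φ), testL2_ae φ,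
      S.coeFn_toLp 2 volume] with x a b c
    rw [toC, a, b, c]
    rfl
  have h2 : fourierL2 (testL2 φ) = (𝓕 S).toLp 2 := by
    rw [fourierL2, h1, SchwartzMap.toLp_fourier_eq]
  rw [h2]
  let g : E d → ℝ := fun ξ => (1 + ‖ξ‖ ^ 2) ^ (s / 2)
  have hg : g.HasTemperateGrowth := Function.hasTemperateGrowth_one_add_norm_sq_rpow (E d) (s / 2)
  have hT := (SchwartzMap.smulLeftCLM ℂ g (𝓕 S)).memLp 2 (volume : Measure (E d))
  refine hT.mono ?_ ?_
  · refine AEStronglyMeasurable.mul (Continuous.aestronglyMeasurable ?_)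
      (Lp.aestronglyMeasurable _)
    exact Complex.continuous_ofReal.comp
      (continuous_norm.rpow_const fun _ => Or.inr hs)
  · filter_upwards [(𝓕 S).coeFn_toLp 2 volume] with x hx
    rw [hx, SchwartzMap.smulLeftCLM_apply_apply hg, norm_mul, norm_smul, Complex.norm_real]
    refine mul_le_mul_of_nonneg_right ?_ (norm_nonneg _)
    rw [Real.norm_of_nonneg (by positivity), Real.norm_of_nonneg (by positivity)]
    change ‖x‖ ^ s ≤ (1 + ‖x‖ ^ 2) ^ (s / 2)
    have : ‖x‖ ^ s = (‖x‖ ^ 2) ^ (s / 2) := by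
      rw [← Real.rpow_natCast, ← Real.rpow_mul (norm_nonneg _)]
      congr 1; push_cast; ring
    rw [this]
    exact Real.rpow_le_rpow (by positivity) (by linarith) (by linarith)

/-! ### The energy space, its norm and its dual -/

/-- The energy space: `tildeH Ω s` if `ι = 0`, and `H^1_0(Ω)` if `ι = 1`. -/
def energySpace (Ω : Opens (E d)) (s : ℝ) (ι : Fin 2) : Submodule ℝ (L2 d) :=
  if ι = 0 then tildeH Ω s else H10 Ω

/-- The energy norm:
`‖w‖² = ‖w‖²_{L²} + ∫ |ξ|^{2s} |F(w)(ξ)|² dξ + ι ‖∇w‖²_{L²(Ω)}`. -/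
def energyNorm (Ω : Opens (E d)) (s : ℝ) (ι : Fin 2) (w : L2 d) : ℝ :=
  Real.sqrt (‖w‖ ^ 2 + fracForm s w w +
    (ι : ℕ) * ∫ x in (Ω : Set (E d)), ‖weakGradient Ω w x‖ ^ 2)

/-- The dual of the energy space: the linear functionals that are bounded for the energy norm. -/
def EnergyDual (Ω : Opens (E d)) (s : ℝ) (ι : Fin 2) : Type :=
  {ℓ : energySpace Ω s ι →ₗ[ℝ] ℝ // ∃ C : ℝ, ∀ w, |ℓ w| ≤ C * energyNorm Ω s ι w}

instance (Ω : Opens (E d)) (s : ℝ) (ι : Fin 2) :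
    CoeFun (EnergyDual Ω s ι) (fun _ => energySpace Ω s ι → ℝ) := ⟨fun ℓ => ℓ.1⟩

theorem testL2_mem_energySpace {Ω : Opens (E d)} (φ : 𝓓(Ω, ℝ)) {s : ℝ} (hs : 0 < s)
    (ι : Fin 2) : testL2 φ ∈ energySpace Ω s ι := by
  unfold energySpace
  split_ifs
  · exact testL2_mem_tildeH φ hs.le
  · exact testL2_mem_H10 φ

/-- A test function as an element of the energy space. -/
def testV {Ω : Opens (E d)} {s : ℝ} (hs : 0 < s) (ι : Fin 2) (φ : 𝓓(Ω, ℝ)) :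
    energySpace Ω s ι := ⟨testL2 φ, testL2_mem_energySpace φ hs ι⟩

/-! ### The bilinear forms -/

/-- The form `∫_Ω (∇w · A ∇v + c v w)` of the second order operator `L w = -div (A ∇w) + c w`. -/
def ellipticForm (Ω : Opens (E d)) (A : E d → Matrix (Fin d) (Fin d) ℝ) (c : E d → ℝ)
    (v w : L2 d) : ℝ :=
  ∫ x in (Ω : Set (E d)), (⟪weakGradient Ω w x, (A x).toEuclideanLin (weakGradient Ω v x)⟫_ℝ +
    c x * v x * w x)

/-- `B` is a continuous bilinear form on the energy space that agrees with
`∫_Ω (β · ∇φ) ψ` on test functions. -/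
def IsDriftExtension (Ω : Opens (E d)) (β : E d → E d) {s : ℝ} (hs : 0 < s) (ι : Fin 2)
    (B : energySpace Ω s ι →ₗ[ℝ] energySpace Ω s ι →ₗ[ℝ] ℝ) : Prop :=
  (∃ C : ℝ, ∀ v w, |B v w| ≤ C * energyNorm Ω s ι v * energyNorm Ω s ι w) ∧
    ∀ φ ψ : 𝓓(Ω, ℝ), B (testV hs ι φ) (testV hs ι ψ) =
      ∫ x in (Ω : Set (E d)), ⟪β x, gradient φ x⟫_ℝ * ψ x

open scoped Classical in
/-- The drift form: the continuous extension of `∫_Ω (β · ∇φ) ψ` from test functions to the energy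
space. In the three admissible cases it exists, and it is unique since test functions are dense in
the energy space of a bounded Lipschitz domain; where there is none the value is zero. -/
def driftForm (Ω : Opens (E d)) (β : E d → E d) {s : ℝ} (hs : 0 < s) (ι : Fin 2) :
    energySpace Ω s ι →ₗ[ℝ] energySpace Ω s ι →ₗ[ℝ] ℝ :=
  if h : ∃ B, IsDriftExtension Ω β hs ι B then h.choose else 0

/-- The full bilinear form on the energy space. -/
def fullForm (Ω : Opens (E d)) (A : E d → Matrix (Fin d) (Fin d) ℝ) (c : E d → ℝ)
    (β : E d → E d) {s : ℝ} (hs : 0 < s) (ι : Fin 2) (v w : energySpace Ω s ι) : ℝ :=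
  (ι : ℕ) * ellipticForm Ω A c (v : L2 d) (w : L2 d) + driftForm Ω β hs ι v w +
    fracForm s (v : L2 d) (w : L2 d)

/-! ### The obstacle problem -/

/-- The admissible set: the elements of the energy space that lie above the obstacle almost
everywhere in `Ω`. -/
def admissibleSet (Ω : Opens (E d)) (s : ℝ) (ι : Fin 2) (χ : E d → ℝ) :
    Set (energySpace Ω s ι) :=
  {w | ∀ᵐ x ∂(volume.restrict (Ω : Set (E d))), χ x ≤ (w : L2 d) x}

/-- `u` solves the variational inequality with load `f`. -/
def IsSolution (Ω : Opens (E d)) (A : E d → Matrix (Fin d) (Fin d) ℝ) (c : E d → ℝ)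
    (β : E d → E d) {s : ℝ} (hs : 0 < s) (ι : Fin 2) (χ : E d → ℝ) (f : EnergyDual Ω s ι)
    (u : energySpace Ω s ι) : Prop :=
  u ∈ admissibleSet Ω s ι χ ∧
    ∀ v ∈ admissibleSet Ω s ι χ, fullForm Ω A c β hs ι u (u - v) ≤ f (u - v)

/-- `Λ = ι L u + β · ∇u + (-Δ)^s u - f` in the dual of the energy space. -/
def IsMultiplier (Ω : Opens (E d)) (A : E d → Matrix (Fin d) (Fin d) ℝ) (c : E d → ℝ)
    (β : E d → E d) {s : ℝ} (hs : 0 < s) (ι : Fin 2) (f : EnergyDual Ω s ι)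
    (u : energySpace Ω s ι) (Λ : EnergyDual Ω s ι) : Prop :=
  ∀ w, Λ w = fullForm Ω A c β hs ι u w - f w

/-! ### Inequalities and products in the sense of distributions -/

/-- `Λ ≥ 0` in the dual space. -/
def IsNonnegDual {Ω : Opens (E d)} {s : ℝ} {ι : Fin 2} (Λ : EnergyDual Ω s ι) : Prop :=
  ∀ w : energySpace Ω s ι, (∀ᵐ x ∂(volume.restrict (Ω : Set (E d))), 0 ≤ (w : L2 d) x) → 0 ≤ Λ w

/-- The functional on test functions induced by an element of the dual space. -/
def distOfDual {Ω : Opens (E d)} {s : ℝ} (hs : 0 < s) {ι : Fin 2} (Λ : EnergyDual Ω s ι) :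
    𝓓(Ω, ℝ) → ℝ := fun φ => Λ (testV hs ι φ)

/-- The functional on test functions induced by a function on `Ω`. -/
def distOfFun (Ω : Opens (E d)) (g : E d → ℝ) : 𝓓(Ω, ℝ) → ℝ :=
  fun φ => ∫ x in (Ω : Set (E d)), g x * φ x

/-- `T ≥ 0` in the sense of distributions. -/
def IsNonnegDist {Ω : Opens (E d)} (T : 𝓓(Ω, ℝ) → ℝ) : Prop :=
  ∀ φ : 𝓓(Ω, ℝ), (∀ x, 0 ≤ φ x) → 0 ≤ T φ

/-- `T h = 0` in the sense of distributions, for a nonnegative `T` and a continuous function `h`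
on `Ω`: `T` is a Radon measure `μ` on `Ω`, and its product `h μ` is the zero distribution. -/
def ProductIsZero {Ω : Opens (E d)} (T : 𝓓(Ω, ℝ) → ℝ) (h : E d → ℝ) : Prop :=
  ∃ μ : Measure Ω, IsFiniteMeasureOnCompacts μ ∧ (∀ φ : 𝓓(Ω, ℝ), T φ = ∫ x : Ω, φ x ∂μ) ∧
    ∀ φ : 𝓓(Ω, ℝ), ∫ x : Ω, h x * φ x ∂μ = 0

end FracObstacle

end

/-! For fixed `u` the functional `Λ = A(u, ·) - f` is linear and bounded on the energy space: the
elliptic and fractional parts are `L²` inner products against data built from `u`, and the drift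
form carries its bound by definition. When `ι = 1` the fractional part also needs `H^1_0 ⊆ tildeH`,
proved by Plancherel and Fatou (`H10_le_tildeH`).

The signs come from admissible variations: if `u + w` stays above the obstacle, the inequality with
`v = u + w` gives `Λ w ≥ 0`. Any `w ≥ 0` qualifies, so `Λ ≥ 0`. If `u` has a continuous version `g`
and `0 ≤ φ ≤ 1` is supported where `g > χ`, compactness gives `g - χ ≥ δ > 0` on the support of `φ`.
Then `-δφ` qualifies too, and `Λ φ = 0`.

A positive functional on test functions is integration against a Radon measure `μ`
(`exists_measure_of_nonneg`). By the previous step `μ` does not charge the open set `{g > χ}`;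
elsewhere in `Ω` the factor `g - χ` is zero, so `(g - χ) μ = 0`. -/

noncomputable section

namespace FracObstacle

variable {d : ℕ}

/-! ### The fractional form as a weighted `L²` inner product -/

/-- The weighted Fourier transform `|ξ|^s F(w)(ξ)` as a linear map into `L²`. -/
def weightedFourier (Ω : Opens (E d)) (s : ℝ) :
    tildeH Ω s →ₗ[ℝ] Lp ℂ 2 (volume : Measure (E d)) where
  toFun w := w.2.2.toLp _
  map_add' v w := by
    rw [← MemLp.toLp_add]
    refine MemLp.toLp_congr _ _ ?_
    have h : fourierL2 ((v + w : tildeH Ω s) : L2 d) = fourierL2 v + fourierL2 w :=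
      fourierL2_add _ _
    rw [h]
    filter_upwards [Lp.coeFn_add (fourierL2 (v : L2 d)) (fourierL2 (w : L2 d))] with x hx
    rw [hx, Pi.add_apply, Pi.add_apply, mul_add]
  map_smul' a w := by
    rw [RingHom.id_apply, ← MemLp.toLp_const_smul]
    refine MemLp.toLp_congr _ _ ?_
    have h : fourierL2 ((a • w : tildeH Ω s) : L2 d) = (a : ℂ) • fourierL2 w :=
      fourierL2_smul _ _
    rw [h]
    filter_upwards [Lp.coeFn_smul (a : ℂ) (fourierL2 (w : L2 d))] with x hx
    simp only [hx, Pi.smul_apply, smul_eq_mul, Complex.real_smul]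
    ring

/-- The symbol splits as `(2π|η|)^{2s} = (2π)^{2s} |η|^s |η|^s`, one factor `|η|^s` going to each
argument. Linearity, positivity and Cauchy–Schwarz are then inherited from `L²`. The arguments are
swapped because the complex inner product is conjugate-linear in its first slot. -/
theorem fracForm_eq_inner {Ω : Opens (E d)} {s : ℝ} (v w : tildeH Ω s) :
    fracForm s (v : L2 d) (w : L2 d) =
      (2 * Real.pi) ^ (2 * s) * (⟪weightedFourier Ω s w, weightedFourier Ω s v⟫_ℂ).re := by
  have hint := L2.integrable_inner (𝕜 := ℂ) (weightedFourier Ω s w) (weightedFourier Ω s v)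
  rw [L2.inner_def, ← RCLike.re_eq_complex_re, ← integral_re hint, ← integral_const_mul, fracForm]
  refine integral_congr_ae ?_
  filter_upwards [v.2.2.coeFn_toLp, w.2.2.coeFn_toLp] with x hv hw
  have e1 : (weightedFourier Ω s v : E d → ℂ) x =
      ((‖x‖ ^ s : ℝ) : ℂ) * fourierL2 (v : L2 d) x := hv
  have e2 : (weightedFourier Ω s w : E d → ℂ) x =
      ((‖x‖ ^ s : ℝ) : ℂ) * fourierL2 (w : L2 d) x := hw
  have e3 : (2 * Real.pi * ‖x‖) ^ (2 * s) = (2 * Real.pi) ^ (2 * s) * (‖x‖ ^ s * ‖x‖ ^ s) := by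
    rw [Real.mul_rpow (by positivity) (norm_nonneg _)]
    congr 1
    rw [mul_comm 2 s, Real.rpow_mul (norm_nonneg _), Real.rpow_two, sq]
  rw [e1, e2, e3, mul_assoc]
  congr 1
  simp only [RCLike.inner_apply, RCLike.re_eq_complex_re, map_mul, Complex.conj_ofReal,
    Complex.mul_re, Complex.mul_im, Complex.ofReal_re, Complex.ofReal_im, Complex.conj_re,
    Complex.conj_im]
  ring

theorem fracForm_self {Ω : Opens (E d)} {s : ℝ} (w : tildeH Ω s) :
    fracForm s (w : L2 d) (w : L2 d) = (2 * Real.pi) ^ (2 * s) * ‖weightedFourier Ω s w‖ ^ 2 := by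
  rw [fracForm_eq_inner, inner_self_eq_norm_sq_to_K]
  norm_cast

theorem fracForm_self_nonneg {Ω : Opens (E d)} {s : ℝ} {w : L2 d} (hw : w ∈ tildeH Ω s) :
    0 ≤ fracForm s w w := by
  lift w to tildeH Ω s using hw
  rw [fracForm_self]; positivity

theorem fracForm_add_right {Ω : Opens (E d)} {s : ℝ} {u v w : L2 d} (hu : u ∈ tildeH Ω s)
    (hv : v ∈ tildeH Ω s) (hw : w ∈ tildeH Ω s) :
    fracForm s u (v + w) = fracForm s u v + fracForm s u w := by
  lift u to tildeH Ω s using hu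
  lift v to tildeH Ω s using hv
  lift w to tildeH Ω s using hw
  rw [← Submodule.coe_add]
  simp only [fracForm_eq_inner, map_add, inner_add_left, Complex.add_re, mul_add]

theorem fracForm_smul_right {Ω : Opens (E d)} {s : ℝ} (a : ℝ) {u w : L2 d}
    (hu : u ∈ tildeH Ω s) (hw : w ∈ tildeH Ω s) :
    fracForm s u (a • w) = a * fracForm s u w := by
  lift u to tildeH Ω s using hu
  lift w to tildeH Ω s using hw
  rw [← Submodule.coe_smul]
  have e : a • weightedFourier Ω s w = (a : ℂ) • weightedFourier Ω s w :=
    (Complex.coe_smul a _).symm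
  rw [fracForm_eq_inner, fracForm_eq_inner, map_smul, e, inner_smul_left, Complex.conj_ofReal,
    Complex.re_ofReal_mul]
  ring

theorem abs_fracForm_le {Ω : Opens (E d)} {s : ℝ} {v w : L2 d} (hv : v ∈ tildeH Ω s)
    (hw : w ∈ tildeH Ω s) :
    |fracForm s v w| ≤ √(fracForm s v v) * √(fracForm s w w) := by
  lift v to tildeH Ω s using hv
  lift w to tildeH Ω s using hw
  have hp : 0 ≤ (2 * Real.pi) ^ (2 * s) := by positivity
  rw [fracForm_self, fracForm_self, fracForm_eq_inner, Real.sqrt_mul hp, Real.sqrt_mul hp,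
    Real.sqrt_sq (norm_nonneg _), Real.sqrt_sq (norm_nonneg _), abs_mul, abs_of_nonneg hp,
    mul_mul_mul_comm, Real.mul_self_sqrt hp]
  refine mul_le_mul_of_nonneg_left ?_ hp
  refine (Complex.abs_re_le_norm _).trans ((norm_inner_le_norm _ _).trans ?_)
  rw [mul_comm]

/-! ### `H^1_0` embeds into the fractional space -/

/-- A real test function as a complex Schwartz function. -/
def testSchwartz {Ω : Opens (E d)} (φ : 𝓓(Ω, ℝ)) : SchwartzMap (E d) ℂ :=
  HasCompactSupport.toSchwartzMap (f := fun x => (φ x : ℂ))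
    (φ.hasCompactSupport.comp_left (g := fun r : ℝ => (r : ℂ)) Complex.ofReal_zero)
    (Complex.ofRealCLM.contDiff.comp φ.contDiff)

theorem testSchwartz_apply {Ω : Opens (E d)} (φ : 𝓓(Ω, ℝ)) (x : E d) :
    testSchwartz φ x = φ x := rfl

theorem fourierL2_testL2_ae {Ω : Opens (E d)} (φ : 𝓓(Ω, ℝ)) :
    fourierL2 (testL2 φ) =ᵐ[volume] (𝓕 (testSchwartz φ) : SchwartzMap (E d) ℂ) := by
  have h1 : toC (testL2 φ) = (testSchwartz φ).toLp 2 := by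
    apply Lp.ext
    filter_upwards [Complex.ofRealCLM.coeFn_compLpL (p := 2) (testL2 φ), testL2_ae φ,
      (testSchwartz φ).coeFn_toLp 2 volume] with x a b c
    rw [toC, a, b, c]
    rfl
  rw [fourierL2, h1, SchwartzMap.toLp_fourier_eq]
  exact (𝓕 (testSchwartz φ)).coeFn_toLp 2 volume

theorem eLpNorm_fourier_schwartz (S : SchwartzMap (E d) ℂ) :
    eLpNorm (𝓕 S : SchwartzMap (E d) ℂ) 2 volume = eLpNorm S 2 volume := by
  have h := Lp.norm_fourier_eq (S.toLp 2)
  rw [SchwartzMap.toLp_fourier_eq, SchwartzMap.norm_toLp, SchwartzMap.norm_toLp] at h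
  exact (ENNReal.toReal_eq_toReal_iff' ((𝓕 S).memLp 2 volume).2.ne (S.memLp 2 volume).2.ne).1 h

/-- The transform of `∂ᵢφ` is `2πi ξᵢ 𝓕φ`. Since `|2πi| ≥ 1` the constant can be dropped, and
Plancherel returns to `∂ᵢφ`, a component of the gradient. -/
theorem eLpNorm_coord_mul_fourier_le {Ω : Opens (E d)} (φ : 𝓓(Ω, ℝ)) (i : Fin d) :
    eLpNorm (fun ξ : E d => (ξ i : ℂ) * 𝓕 (testSchwartz φ) ξ) 2 volume ≤
      eLpNorm (gradient φ) 2 volume := by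
  set m : E d := EuclideanSpace.single i (1 : ℝ) with hm
  have htg : (fun ξ : E d => ⟪ξ, m⟫_ℝ).HasTemperateGrowth :=
    ((innerSL ℝ).flip m).hasTemperateGrowth
  have hin : ∀ ξ : E d, ⟪ξ, m⟫_ℝ = ξ i := fun ξ => by
    rw [hm, EuclideanSpace.inner_single_right]; simp
  have h1 : eLpNorm (fun ξ : E d => (ξ i : ℂ) * 𝓕 (testSchwartz φ) ξ) 2 volume ≤
      eLpNorm (𝓕 (LineDeriv.lineDerivOp m (testSchwartz φ)) : SchwartzMap (E d) ℂ) 2 volume := by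
    refine eLpNorm_mono fun ξ => ?_
    rw [SchwartzMap.fourier_lineDerivOp_eq, smul_apply,
      SchwartzMap.smulLeftCLM_apply_apply htg, hin, norm_smul, norm_smul, norm_mul,
      Complex.norm_real]
    have : (1 : ℝ) ≤ ‖(2 * Real.pi * Complex.I : ℂ)‖ := by
      simp only [norm_mul, Complex.norm_ofNat, Complex.norm_real, Complex.norm_I, mul_one,
        Real.norm_eq_abs, abs_of_pos Real.pi_pos]
      linarith [Real.pi_gt_three]
    exact le_mul_of_one_le_left (by positivity) this
  refine h1.trans ?_
  rw [eLpNorm_fourier_schwartz]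
  refine eLpNorm_mono fun x => ?_
  have h2 : LineDeriv.lineDerivOp m (testSchwartz φ) x = ((gradient φ x i : ℝ) : ℂ) := by
    have hd : HasFDerivAt (fun y => (φ y : ℂ)) (Complex.ofRealCLM.comp (fderiv ℝ φ x)) x :=
      Complex.ofRealCLM.hasFDerivAt.comp x (φ.contDiff.differentiable (by simp) x).hasFDerivAt
    have hd' : fderiv ℝ (testSchwartz φ) x = Complex.ofRealCLM.comp (fderiv ℝ φ x) := hd.fderiv
    rw [SchwartzMap.lineDerivOp_apply_eq_fderiv, hd', gradient_apply]
    rfl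
  rw [h2, Complex.norm_real]
  exact PiLp.norm_apply_le _ i

/-- For `‖ξ‖ ≤ 1` the left side is at most `1`; otherwise it is at most `‖ξ‖`, hence at most the
`ℓ¹` norm. The `ℓ¹` norm is used because each `|ξᵢ|` corresponds to a partial derivative. -/
theorem rpow_norm_le_one_add_sum {s : ℝ} (hs₀ : 0 ≤ s) (hs₁ : s ≤ 1) (ξ : E d) :
    ‖ξ‖ ^ s ≤ 1 + ∑ i, |ξ i| := by
  have h1 : ‖ξ‖ ≤ ∑ i, |ξ i| := by
    have h := norm_sum_le Finset.univ fun i => EuclideanSpace.single i (ξ i)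
    have e : ∑ i, EuclideanSpace.single i (ξ i) = ξ := by
      ext j; simp [Finset.sum_apply, Pi.single_apply]
    rw [e] at h
    simpa using h
  rcases le_total ‖ξ‖ 1 with h | h
  · exact (Real.rpow_le_one (norm_nonneg _) h hs₀).trans
      (le_add_of_nonneg_right (Finset.sum_nonneg fun _ _ => abs_nonneg _))
  · calc ‖ξ‖ ^ s ≤ ‖ξ‖ ^ (1 : ℝ) := Real.rpow_le_rpow_of_exponent_le h hs₁
      _ ≤ 1 + ∑ i, |ξ i| := by rw [Real.rpow_one]; linarith

theorem eLpNorm_weightedFourier_test_le {Ω : Opens (E d)} {s : ℝ} (hs₀ : 0 ≤ s) (hs₁ : s ≤ 1)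
    (φ : 𝓓(Ω, ℝ)) :
    eLpNorm (fun ξ : E d => ((‖ξ‖ ^ s : ℝ) : ℂ) * fourierL2 (testL2 φ) ξ) 2 volume ≤
      eLpNorm φ 2 volume + d * eLpNorm (gradient φ) 2 volume := by
  set S := testSchwartz φ
  have hm : ∀ i : Fin d, AEStronglyMeasurable (fun ξ : E d => (ξ i : ℂ) * 𝓕 S ξ) volume :=
    fun i => Continuous.aestronglyMeasurable
      ((Complex.continuous_ofReal.comp (EuclideanSpace.proj i : E d →L[ℝ] ℝ).continuous).mul
        (𝓕 S).continuous)
  calc eLpNorm (fun ξ : E d => ((‖ξ‖ ^ s : ℝ) : ℂ) * fourierL2 (testL2 φ) ξ) 2 volume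
      ≤ eLpNorm ((fun ξ => ‖𝓕 S ξ‖) + ∑ i : Fin d, fun ξ : E d => ‖(ξ i : ℂ) * 𝓕 S ξ‖)
          2 volume := by
        refine eLpNorm_mono_ae_real ?_
        filter_upwards [fourierL2_testL2_ae φ] with ξ hξ
        rw [hξ, norm_mul, Complex.norm_real, Real.norm_of_nonneg (by positivity), Pi.add_apply,
          Finset.sum_apply]
        simp only [norm_mul, Complex.norm_real, Real.norm_eq_abs]
        rw [← Finset.sum_mul]
        calc ‖ξ‖ ^ s * ‖𝓕 S ξ‖ ≤ (1 + ∑ i, |ξ i|) * ‖𝓕 S ξ‖ := by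
              gcongr; exact rpow_norm_le_one_add_sum hs₀ hs₁ ξ
          _ = ‖𝓕 S ξ‖ + (∑ i, |ξ i|) * ‖𝓕 S ξ‖ := by ring
    _ ≤ eLpNorm (fun ξ => ‖𝓕 S ξ‖) 2 volume +
          ∑ i : Fin d, eLpNorm (fun ξ : E d => ‖(ξ i : ℂ) * 𝓕 S ξ‖) 2 volume := by
        refine (eLpNorm_add_le (𝓕 S).continuous.norm.aestronglyMeasurable
          (Finset.aestronglyMeasurable_sum _ fun i _ => (hm i).norm) (by norm_num)).trans ?_
        gcongr
        exact eLpNorm_sum_le (fun i _ => (hm i).norm) (by norm_num)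
    _ ≤ eLpNorm φ 2 volume + ∑ _i : Fin d, eLpNorm (gradient φ) 2 volume := by
        gcongr with i
        · rw [eLpNorm_norm, eLpNorm_fourier_schwartz]
          exact eLpNorm_mono fun x => by rw [testSchwartz_apply, Complex.norm_real]
        · rw [eLpNorm_norm]
          exact eLpNorm_coord_mul_fourier_le φ i
    _ = _ := by simp

theorem eLpNorm_restrict_eq_of_support {F : Type*} [NormedAddCommGroup F] {Ω : Opens (E d)}
    {h : E d → F} (hh : ∀ᵐ x, x ∉ Ω → h x = 0) :
    eLpNorm h 2 (volume.restrict (Ω : Set (E d))) = eLpNorm h 2 volume := by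
  rw [← eLpNorm_indicator_eq_eLpNorm_restrict Ω.isOpen.measurableSet]
  refine eLpNorm_congr_ae ?_
  filter_upwards [hh] with x hx
  by_cases hm : x ∈ (Ω : Set (E d))
  · rw [indicator_of_mem hm]
  · rw [indicator_of_notMem hm, hx hm]

theorem gradient_eq_zero {Ω : Opens (E d)} (φ : 𝓓(Ω, ℝ)) {x : E d} (hx : x ∉ Ω) :
    gradient φ x = 0 := by
  have : x ∉ tsupport (fderiv ℝ φ) := fun h =>
    hx (φ.tsupport_subset (tsupport_fderiv_subset ℝ h))
  rw [gradient, image_eq_zero_of_notMem_tsupport this, map_zero]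

open Filter Topology in
-- Approximating test functions are bounded in `H^1`, so their weighted transforms are bounded in
-- `L²`. Fatou's lemma passes this bound to the limit; only finiteness is needed, not convergence of
-- the weighted transforms.
theorem H10_le_tildeH {Ω : Opens (E d)} {s : ℝ} (hs₀ : 0 ≤ s) (hs₁ : s ≤ 1) :
    H10 Ω ≤ tildeH Ω s := by
  rintro u ⟨hu0, G, hG, hlim⟩
  refine ⟨hu0, ?_⟩
  have hpos : ∀ n : ℕ, (0 : ℝ≥0∞) < (n + 1 : ℝ≥0∞)⁻¹ := fun n => by simp
  choose φ h1 h2 using fun n : ℕ => hlim _ (hpos n)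
  have hone : ∀ n : ℕ, (n + 1 : ℝ≥0∞)⁻¹ ≤ 1 := fun n => by
    rw [ENNReal.inv_le_one]; exact le_add_self
  -- Both functions vanish off `Ω`, so the approximation holds on the whole space, where the Fourier
  -- transform acts.
  have h1' : ∀ n, eLpNorm (fun x => u x - φ n x) 2 volume ≤ (n + 1 : ℝ≥0∞)⁻¹ := fun n => by
    rw [← eLpNorm_restrict_eq_of_support (Ω := Ω)]
    · exact h1 n
    · filter_upwards [hu0] with x hx hm
      rw [hx hm, test_eq_zero _ hm, sub_zero]
  have hφ : ∀ n, eLpNorm (φ n) 2 volume ≤ eLpNorm u 2 volume + 1 := fun n => by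
    have e : (φ n : E d → ℝ) = (u : E d → ℝ) - fun x => u x - φ n x := by
      funext x; simp
    rw [e]
    refine (eLpNorm_sub_le (Lp.memLp u).1 ((Lp.memLp u).sub (memLp_test (φ n) 2 _)).1
      (by norm_num)).trans ?_
    gcongr
    exact (h1' n).trans (hone n)
  have hgr : ∀ n, eLpNorm (gradient (φ n)) 2 volume ≤
      eLpNorm G 2 (volume.restrict (Ω : Set (E d))) + 1 := fun n => by
    rw [← eLpNorm_restrict_eq_of_support (Ω := Ω)
      (Eventually.of_forall fun x hx => gradient_eq_zero (φ n) hx)]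
    have e : gradient (φ n) = G - fun x => G x - gradient (φ n) x := by
      funext x; simp
    conv_lhs => rw [e]
    refine (eLpNorm_sub_le hG.1.1 (hG.1.sub (memLp_gradient (φ n))).1 (by norm_num)).trans ?_
    gcongr
    exact (h2 n).trans (hone n)
  have hconv : Tendsto (fun n => testL2 (φ n)) atTop (𝓝 u) := by
    rw [Lp.tendsto_Lp_iff_tendsto_eLpNorm']
    refine tendsto_of_tendsto_of_tendsto_of_le_of_le tendsto_const_nhds
      ENNReal.tendsto_inv_nat_nhds_zero (fun _ => zero_le) fun n => ?_
    refine le_trans (le_of_eq ?_) ((h1' n).trans (ENNReal.inv_le_inv.2 le_self_add))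
    rw [eLpNorm_sub_comm]
    refine eLpNorm_congr_ae ?_
    filter_upwards [testL2_ae (φ n)] with x hx
    rw [Pi.sub_apply, hx]
  have hcF : Continuous (fourierL2 (d := d)) :=
    (Lp.fourierTransformₗᵢ (E d) ℂ).continuous.comp (Complex.ofRealCLM.compLpL 2 volume).continuous
  have hF : Tendsto (fun n => fourierL2 (testL2 (φ n))) atTop (𝓝 (fourierL2 u)) :=
    (hcF.tendsto u).comp hconv
  -- Fatou needs pointwise convergence: `L²` convergence gives convergence in measure, hence almost
  -- everywhere along a subsequence.
  obtain ⟨ns, -, hns⟩ := (tendstoInMeasure_of_tendsto_Lp hF).exists_seq_tendsto_ae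
  have hw : Continuous fun ξ : E d => ((‖ξ‖ ^ s : ℝ) : ℂ) :=
    Complex.continuous_ofReal.comp (continuous_norm.rpow_const fun _ => Or.inr hs₀)
  have hmeas : ∀ v : L2 d, AEStronglyMeasurable
      (fun ξ : E d => ((‖ξ‖ ^ s : ℝ) : ℂ) * fourierL2 v ξ) volume := fun v =>
    hw.aestronglyMeasurable.mul (Lp.aestronglyMeasurable _)
  refine ⟨hmeas u, ?_⟩
  have hfatou := Lp.eLpNorm_lim_le_liminf_eLpNorm (p := 2)
    (fun n => hmeas (testL2 (φ (ns n)))) _ (hns.mono fun ξ hξ => hξ.const_mul ((‖ξ‖ ^ s : ℝ) : ℂ))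
  refine hfatou.trans_lt (lt_of_le_of_lt
    (b := (eLpNorm u 2 volume + 1) + d * (eLpNorm G 2 (volume.restrict (Ω : Set (E d))) + 1))
    ?_ ?_)
  · refine liminf_le_of_le (by isBoundedDefault) fun b hb => ?_
    obtain ⟨n, hn⟩ := hb.exists
    refine hn.trans ((eLpNorm_weightedFourier_test_le hs₀ hs₁ _).trans ?_)
    gcongr
    · exact hφ _
    · exact hgr _
  · have a := (Lp.memLp u).2
    have b := hG.1.2
    exact ENNReal.add_lt_top.2 ⟨ENNReal.add_lt_top.2 ⟨a, by simp⟩,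
      ENNReal.mul_lt_top (by simp) (ENNReal.add_lt_top.2 ⟨b, by simp⟩)⟩

theorem energySpace_le_tildeH {Ω : Opens (E d)} {s : ℝ} (hs₀ : 0 ≤ s) (hs₁ : s ≤ 1) (ι : Fin 2) :
    energySpace Ω s ι ≤ tildeH Ω s := by
  unfold energySpace
  split_ifs
  · exact le_rfl
  · exact H10_le_tildeH hs₀ hs₁

/-! ### Weak gradients and the elliptic form -/

section WeakGradient

theorem weakGradient_spec {Ω : Opens (E d)} {u : L2 d} (h : ∃ G, HasWeakGradient Ω u G) :
    HasWeakGradient Ω u (weakGradient Ω u) := by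
  rw [weakGradient, dif_pos h]
  exact h.choose_spec

/-- Fundamental lemma of the calculus of variations, applied to each component of `G - H`. As
`weakGradient` is an arbitrary choice, this uniqueness is what makes it linear almost everywhere. -/
theorem HasWeakGradient.ae_eq {Ω : Opens (E d)} {u : L2 d} {G H : E d → E d}
    (hG : HasWeakGradient Ω u G) (hH : HasWeakGradient Ω u H) :
    G =ᵐ[volume.restrict (Ω : Set (E d))] H := by
  have key : ∀ i : Fin d, ∀ᵐ x, x ∈ (Ω : Set (E d)) → G x i - H x i = 0 := fun i => by
    have hm := (memLp_coord hG.1 i).sub (memLp_coord hH.1 i)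
    refine Ω.isOpen.ae_eq_zero_of_integral_contDiff_smul_eq_zero
      (locallyIntegrableOn_of_locallyIntegrable_restrict (hm.locallyIntegrable (by norm_num)))
      fun φ hφ hc hs => ?_
    let ψ : 𝓓(Ω, ℝ) := ⟨φ, hφ, hc, hs⟩
    have hψ := memLp_test ψ 2 (volume.restrict (Ω : Set (E d)))
    have e1 : ∫ x in (Ω : Set (E d)), G x i * ψ x = ∫ x in (Ω : Set (E d)), H x i * ψ x := by
      rw [← neg_inj, ← hG.2 ψ i, ← hH.2 ψ i]
    have e2 : ∫ x in (Ω : Set (E d)), (G x i * ψ x - H x i * ψ x) = 0 := by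
      have i1 : IntegrableOn (fun x => G x i * ψ x) Ω := (memLp_coord hG.1 i).integrable_mul hψ
      have i2 : IntegrableOn (fun x => H x i * ψ x) Ω := (memLp_coord hH.1 i).integrable_mul hψ
      rw [integral_sub i1 i2, e1, sub_self]
    rw [← e2, setIntegral_eq_integral_of_forall_compl_eq_zero fun x hx => by
      rw [test_eq_zero ψ hx, mul_zero, mul_zero, sub_zero]]
    refine integral_congr_ae (Filter.Eventually.of_forall fun x => ?_)
    change φ x * (G x i - H x i) = G x i * φ x - H x i * φ x
    ring
  rw [Filter.EventuallyEq, ae_restrict_iff' Ω.isOpen.measurableSet]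
  filter_upwards [ae_all_iff.2 key] with x hx hm
  ext i
  exact sub_eq_zero.1 (hx i hm)

theorem weakGradient_add_ae {Ω : Opens (E d)} {v w : L2 d} (hv : ∃ G, HasWeakGradient Ω v G)
    (hw : ∃ G, HasWeakGradient Ω w G) :
    weakGradient Ω (v + w) =ᵐ[volume.restrict (Ω : Set (E d))]
      weakGradient Ω v + weakGradient Ω w :=
  have h := (weakGradient_spec hv).add (weakGradient_spec hw)
  (weakGradient_spec ⟨_, h⟩).ae_eq h

theorem weakGradient_smul_ae {Ω : Opens (E d)} (a : ℝ) {w : L2 d}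
    (hw : ∃ G, HasWeakGradient Ω w G) :
    weakGradient Ω (a • w) =ᵐ[volume.restrict (Ω : Set (E d))] a • weakGradient Ω w :=
  have h := (weakGradient_spec hw).smul a
  (weakGradient_spec ⟨_, h⟩).ae_eq h

/-- A Lipschitz coefficient on the closure of a bounded open set is bounded. -/
theorem memLp_top_of_lipschitzOn {Ω : Opens (E d)} (hΩ : Bornology.IsBounded (Ω : Set (E d)))
    {a : E d → ℝ} {K : ℝ≥0} (ha : LipschitzOnWith K a (closure (Ω : Set (E d)))) :
    MemLp a ∞ (volume.restrict (Ω : Set (E d))) := by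
  obtain ⟨C, hC⟩ := hΩ.isCompact_closure.exists_bound_of_continuousOn ha.continuousOn
  refine memLp_top_of_bound ((ha.continuousOn.mono subset_closure).aestronglyMeasurable
    Ω.isOpen.measurableSet) C ?_
  rw [ae_restrict_iff' Ω.isOpen.measurableSet]
  exact Filter.Eventually.of_forall fun x hx => hC x (subset_closure hx)

/-- The flux `A G` of a square integrable field `G` is square integrable. -/
theorem memLp_flux {Ω : Opens (E d)} (hΩ : Bornology.IsBounded (Ω : Set (E d)))
    {A : E d → Matrix (Fin d) (Fin d) ℝ}
    (hA : ∀ i j, ∃ K : ℝ≥0, LipschitzOnWith K (fun x => A x i j) (closure (Ω : Set (E d))))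
    {G : E d → E d} (hG : MemLp G 2 (volume.restrict (Ω : Set (E d)))) :
    MemLp (fun x => (A x).toEuclideanLin (G x)) 2 (volume.restrict (Ω : Set (E d))) := by
  refine MemLp.of_eval_piLp fun i => ?_
  have e : (fun x => (A x).toEuclideanLin (G x) i) = fun x => ∑ j, A x i j * G x j := by
    funext x
    simp [Matrix.toLpLin_apply, Matrix.mulVec, dotProduct]
  rw [e]
  refine memLp_finsetSum _ fun j _ => ?_
  obtain ⟨K, hK⟩ := hA i j
  exact (memLp_coord hG j).mul' (memLp_top_of_lipschitzOn hΩ hK)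

theorem memLp_reaction {Ω : Opens (E d)} (hΩ : Bornology.IsBounded (Ω : Set (E d)))
    {c : E d → ℝ} {K : ℝ≥0} (hc : LipschitzOnWith K c (closure (Ω : Set (E d)))) (u : L2 d) :
    MemLp (fun x => c x * u x) 2 (volume.restrict (Ω : Set (E d))) :=
  ((Lp.memLp u).restrict _).mul' (memLp_top_of_lipschitzOn hΩ hc)

variable {Ω : Opens (E d)} {A : E d → Matrix (Fin d) (Fin d) ℝ} {c : E d → ℝ}

/-- Take `P = A ∇u` and `q = c u`, both in `L²` because the coefficients are bounded on `Ω`. With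
`u` frozen, linearity and boundedness in `w` become properties of inner products with fixed vectors.
-/
theorem ellipticForm_eq_inner (hΩ : Bornology.IsBounded (Ω : Set (E d)))
    (hA : IsEllipticCoefficient Ω A) (hc : IsReactionCoefficient Ω c) {u : L2 d}
    (hu : ∃ G, HasWeakGradient Ω u G) :
    ∃ (P : Lp (E d) 2 (volume.restrict (Ω : Set (E d))))
      (q : Lp ℝ 2 (volume.restrict (Ω : Set (E d)))),
      ∀ (w : L2 d) (hw : ∃ G, HasWeakGradient Ω w G),
        ellipticForm Ω A c u w = ⟪P, (weakGradient_spec hw).1.toLp _⟫_ℝ +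
          ⟪q, ((Lp.memLp w).restrict (Ω : Set (E d))).toLp _⟫_ℝ := by
  obtain ⟨K, hK⟩ := hc.1
  have hP := memLp_flux hΩ hA.1 (weakGradient_spec hu).1
  have hq := memLp_reaction hΩ hK u
  refine ⟨hP.toLp _, hq.toLp _, fun w hw => ?_⟩
  rw [L2.inner_def, L2.inner_def,
    ← integral_add (L2.integrable_inner _ _) (L2.integrable_inner _ _), ellipticForm]
  refine integral_congr_ae ?_
  filter_upwards [hP.coeFn_toLp, hq.coeFn_toLp, (weakGradient_spec hw).1.coeFn_toLp,
    ((Lp.memLp w).restrict (Ω : Set (E d))).coeFn_toLp] with x h1 h2 h3 h4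
  rw [h1, h2, h3, h4, real_inner_comm]
  simp only [RCLike.inner_apply, conj_trivial]
  ring

theorem ellipticForm_add_right (hΩ : Bornology.IsBounded (Ω : Set (E d)))
    (hA : IsEllipticCoefficient Ω A) (hc : IsReactionCoefficient Ω c) {u v w : L2 d}
    (hu : ∃ G, HasWeakGradient Ω u G) (hv : ∃ G, HasWeakGradient Ω v G)
    (hw : ∃ G, HasWeakGradient Ω w G) :
    ellipticForm Ω A c u (v + w) = ellipticForm Ω A c u v + ellipticForm Ω A c u w := by
  obtain ⟨P, q, h⟩ := ellipticForm_eq_inner hΩ hA hc hu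
  have hvw : ∃ G, HasWeakGradient Ω (v + w) G :=
    ⟨_, (weakGradient_spec hv).add (weakGradient_spec hw)⟩
  have e1 : (weakGradient_spec hvw).1.toLp _ =
      (weakGradient_spec hv).1.toLp _ + (weakGradient_spec hw).1.toLp _ := by
    rw [← MemLp.toLp_add]
    exact MemLp.toLp_congr _ _ (weakGradient_add_ae hv hw)
  have e2 : ((Lp.memLp (v + w)).restrict (Ω : Set (E d))).toLp _ =
      ((Lp.memLp v).restrict (Ω : Set (E d))).toLp _ +
        ((Lp.memLp w).restrict (Ω : Set (E d))).toLp _ := by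
    rw [← MemLp.toLp_add]
    exact MemLp.toLp_congr _ _ (ae_restrict_of_ae (Lp.coeFn_add v w))
  rw [h _ hvw, h _ hv, h _ hw, e1, e2, inner_add_right, inner_add_right]
  ring

theorem ellipticForm_smul_right (hΩ : Bornology.IsBounded (Ω : Set (E d)))
    (hA : IsEllipticCoefficient Ω A) (hc : IsReactionCoefficient Ω c) {u w : L2 d} (a : ℝ)
    (hu : ∃ G, HasWeakGradient Ω u G) (hw : ∃ G, HasWeakGradient Ω w G) :
    ellipticForm Ω A c u (a • w) = a * ellipticForm Ω A c u w := by
  obtain ⟨P, q, h⟩ := ellipticForm_eq_inner hΩ hA hc hu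
  have haw : ∃ G, HasWeakGradient Ω (a • w) G := ⟨_, (weakGradient_spec hw).smul a⟩
  have e1 : (weakGradient_spec haw).1.toLp _ = a • (weakGradient_spec hw).1.toLp _ := by
    rw [← MemLp.toLp_const_smul]
    exact MemLp.toLp_congr _ _ (weakGradient_smul_ae a hw)
  have e2 : ((Lp.memLp (a • w)).restrict (Ω : Set (E d))).toLp _ =
      a • ((Lp.memLp w).restrict (Ω : Set (E d))).toLp _ := by
    rw [← MemLp.toLp_const_smul]
    exact MemLp.toLp_congr _ _ (ae_restrict_of_ae (Lp.coeFn_smul a w))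
  rw [h _ haw, h _ hw, e1, e2, real_inner_smul_right, real_inner_smul_right]
  ring

theorem exists_abs_ellipticForm_le (hΩ : Bornology.IsBounded (Ω : Set (E d)))
    (hA : IsEllipticCoefficient Ω A) (hc : IsReactionCoefficient Ω c) {u : L2 d}
    (hu : ∃ G, HasWeakGradient Ω u G) :
    ∃ C : ℝ, 0 ≤ C ∧ ∀ w : L2 d, (∃ G, HasWeakGradient Ω w G) →
      |ellipticForm Ω A c u w| ≤
        C * √(‖w‖ ^ 2 + ∫ x in (Ω : Set (E d)), ‖weakGradient Ω w x‖ ^ 2) := by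
  obtain ⟨P, q, h⟩ := ellipticForm_eq_inner hΩ hA hc hu
  refine ⟨‖P‖ + ‖q‖, by positivity, fun w hw => ?_⟩
  set I := ∫ x in (Ω : Set (E d)), ‖weakGradient Ω w x‖ ^ 2
  have hI : 0 ≤ I := integral_nonneg fun x => by positivity
  have hn : ‖(weakGradient_spec hw).1.toLp _‖ ≤ √(‖w‖ ^ 2 + I) := by
    refine Real.le_sqrt_of_sq_le ?_
    have e : ‖(weakGradient_spec hw).1.toLp _‖ ^ 2 = I := by
      rw [← real_inner_self_eq_norm_sq, L2.inner_def]
      refine integral_congr_ae ?_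
      filter_upwards [(weakGradient_spec hw).1.coeFn_toLp] with x hx
      rw [hx, real_inner_self_eq_norm_sq]
    rw [e]
    exact le_add_of_nonneg_left (by positivity)
  have hm : ‖((Lp.memLp w).restrict (Ω : Set (E d))).toLp _‖ ≤ √(‖w‖ ^ 2 + I) := by
    refine le_trans ?_ (Real.le_sqrt_of_sq_le (le_add_of_nonneg_right hI))
    rw [Lp.norm_toLp, Lp.norm_def]
    exact ENNReal.toReal_mono (Lp.memLp w).2.ne
      (eLpNorm_mono_measure _ Measure.restrict_le_self)
  rw [h w hw, add_mul]
  refine (abs_add_le _ _).trans (add_le_add ?_ ?_)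
  · exact (abs_real_inner_le_norm _ _).trans (mul_le_mul_of_nonneg_left hn (norm_nonneg _))
  · exact (abs_real_inner_le_norm _ _).trans (mul_le_mul_of_nonneg_left hm (norm_nonneg _))

end WeakGradient

/-! ### Positive functionals on test functions as Radon measures -/

section RadonMeasure

open scoped CompactlySupported Manifold

theorem exists_test_eq_one {Ω : Opens (E d)} {K U : Set (E d)} (hK : IsCompact K) (hU : IsOpen U)
    (hUΩ : U ⊆ Ω) (hKU : K ⊆ U) :
    ∃ φ : 𝓓(Ω, ℝ), (∀ x, 0 ≤ φ x) ∧ (∀ x, φ x ≤ 1) ∧ (∀ x ∈ K, φ x = 1) ∧ tsupport φ ⊆ U := by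
  obtain ⟨L, hL, hKL, hLU⟩ := exists_compact_between hK hU hKU
  -- The support of `φ` is exactly the interior of the intermediate compact set `L`, which gives
  -- compact support inside `U`.
  obtain ⟨φ, hφ, hr, hs, h1⟩ := exists_contMDiff_support_eq_eq_one_iff 𝓘(ℝ, E d) (n := (⊤ : ℕ∞))
    isOpen_interior hK.isClosed hKL
  have hsub : tsupport φ ⊆ L := by
    rw [tsupport, hs]
    exact closure_minimal interior_subset hL.isClosed
  refine ⟨⟨φ, hφ.contDiff, hL.of_isClosed_subset (isClosed_tsupport _) hsub,
    hsub.trans (hLU.trans hUΩ)⟩, fun x => (hr ⟨x, rfl⟩).1, fun x => (hr ⟨x, rfl⟩).2,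
    fun x hx => (h1 x).1 hx, hsub.trans hLU⟩

/-- The restriction of a test function to `Ω`, as a compactly supported continuous function. -/
def testRestrict (Ω : Opens (E d)) : 𝓓(Ω, ℝ) →ₗ[ℝ] C_c(Ω, ℝ) where
  toFun φ := ⟨⟨fun x => φ x, φ.continuous.comp continuous_subtype_val⟩, by
    refine HasCompactSupport.intro (K := ((↑) : Ω → E d) ⁻¹' tsupport φ) ?_ fun x hx =>
      image_eq_zero_of_notMem_tsupport (f := φ) hx
    refine (Topology.IsInducing.subtypeVal.isCompact_preimage_iff ?_).2
      φ.hasCompactSupport.isCompact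
    rw [Subtype.range_coe]
    exact φ.tsupport_subset⟩
  map_add' _ _ := rfl
  map_smul' _ _ := rfl

theorem testRestrict_injective (Ω : Opens (E d)) : Function.Injective (testRestrict Ω) := by
  intro φ ψ h
  ext x
  by_cases hx : x ∈ Ω
  · exact congrArg (fun f : C_c(Ω, ℝ) => f ⟨x, hx⟩) h
  · rw [test_eq_zero φ hx, test_eq_zero ψ hx]

/-- Every compactly supported continuous function on `Ω` is dominated by a test function. -/
theorem exists_test_ge {Ω : Opens (E d)} (f : C_c(Ω, ℝ)) :
    ∃ φ : 𝓓(Ω, ℝ), ∀ x : Ω, f x ≤ φ x := by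
  obtain ⟨C, hC⟩ := f.continuous.bounded_above_of_compact_support f.hasCompactSupport
  have hK : IsCompact (((↑) : Ω → E d) '' tsupport f) :=
    f.hasCompactSupport.isCompact.image continuous_subtype_val
  obtain ⟨φ, h0, -, h1, -⟩ := exists_test_eq_one (Ω := Ω) hK Ω.isOpen subset_rfl
    (by rintro _ ⟨x, -, rfl⟩; exact x.2)
  refine ⟨C • φ, fun x => ?_⟩
  change f x ≤ C * φ x
  by_cases hx : x ∈ tsupport f
  · rw [h1 x ⟨x, hx, rfl⟩, mul_one]
    exact (le_abs_self _).trans (hC x)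
  · rw [image_eq_zero_of_notMem_tsupport hx]
    exact mul_nonneg ((norm_nonneg _).trans (hC x)) (h0 x)

/-- A positive linear functional on test functions is a Radon measure. -/
theorem exists_measure_of_nonneg {Ω : Opens (E d)} (T : 𝓓(Ω, ℝ) →ₗ[ℝ] ℝ)
    (hT : ∀ φ : 𝓓(Ω, ℝ), (∀ x, 0 ≤ φ x) → 0 ≤ T φ) :
    ∃ μ : Measure Ω, IsFiniteMeasureOnCompacts μ ∧ ∀ φ : 𝓓(Ω, ℝ), T φ = ∫ x : Ω, φ x ∂μ := by
  let e := LinearEquiv.ofInjective (testRestrict Ω) (testRestrict_injective Ω)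
  -- `T` is regarded as a functional on the subspace of restricted test functions. M. Riesz's
  -- extension theorem makes it a positive functional on all of `C_c(Ω)`, so no approximation by
  -- smooth functions is needed.
  let F : C_c(Ω, ℝ) →ₗ.[ℝ] ℝ := ⟨LinearMap.range (testRestrict Ω), T ∘ₗ e.symm.toLinearMap⟩
  let P : PointedCone ℝ C_c(Ω, ℝ) :=
    { carrier := {f | ∀ x, 0 ≤ f x}
      add_mem' := fun hf hg x => add_nonneg (hf x) (hg x)
      zero_mem' := fun _ => le_rfl
      smul_mem' := fun a _ hf x => mul_nonneg a.2 (hf x) }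
  have hF : ∀ φ, F (e φ) = T φ := fun φ => by
    change T (e.symm (e φ)) = T φ
    rw [e.symm_apply_apply]
  obtain ⟨g, hg, hpos⟩ := riesz_extension P F
    (fun f hf => by
      obtain ⟨φ, rfl⟩ := e.surjective f
      rw [hF]
      refine hT φ fun x => ?_
      by_cases hx : x ∈ Ω
      · exact hf ⟨x, hx⟩
      · exact (test_eq_zero φ hx).ge)
    -- Cofinality hypothesis of the extension theorem: a test function dominating `-f` has
    -- nonnegative sum with `f`.
    (fun f => by
      obtain ⟨φ, hφ⟩ := exists_test_ge (-f)
      refine ⟨e φ, fun x => ?_⟩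
      have h : -f x ≤ φ x := hφ x
      change 0 ≤ φ x + f x
      linarith)
  have : LocallyCompactSpace Ω := Ω.isOpen.locallyCompactSpace
  let Λ : C_c(Ω, ℝ) →ₚ[ℝ] ℝ := PositiveLinearMap.mk₀ g fun f hf => hpos f fun x => hf x
  refine ⟨RealRMK.rieszMeasure Λ, inferInstance, fun φ => ?_⟩
  rw [← hF, ← hg (e φ)]
  exact (RealRMK.integral_rieszMeasure Λ (testRestrict Ω φ)).symm

/-- Around each point of `O` lies a bump supported in `O` with zero integral. Being nonnegative, it
vanishes almost everywhere, so the open set where it is nonzero is null. A locally null set is null.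
-/
theorem measure_eq_zero_of_forall_test {Ω : Opens (E d)} (μ : Measure Ω)
    [IsFiniteMeasureOnCompacts μ] {O : Set (E d)} (hO : IsOpen O) (hOΩ : O ⊆ Ω)
    (h : ∀ φ : 𝓓(Ω, ℝ), (∀ x, 0 ≤ φ x) → (∀ x, φ x ≤ 1) → tsupport φ ⊆ O → ∫ x : Ω, φ x ∂μ = 0) :
    μ {x : Ω | (x : E d) ∈ O} = 0 := by
  refine measure_null_of_locally_null _ fun x hx => ?_
  obtain ⟨φ, h0, hle, h1, hs⟩ := exists_test_eq_one (K := {(x : E d)}) isCompact_singleton hO hOΩ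
    (singleton_subset_iff.2 hx)
  have hz := (integral_eq_zero_iff_of_nonneg (f := fun y : Ω => φ y) (fun y => h0 y)
    (testRestrict Ω φ).integrable).1 (h φ h0 hle hs)
  refine ⟨{y : Ω | φ y ≠ 0}, mem_nhdsWithin_of_mem_nhds (IsOpen.mem_nhds ?_ ?_), hz⟩
  · exact isOpen_ne_fun (φ.continuous.comp continuous_subtype_val) continuous_const
  · change φ x ≠ 0
    rw [h1 x rfl]
    exact one_ne_zero

end RadonMeasure

/-! ### Energy norm bounds and the drift form -/

theorem exists_weakGradient_of_mem {Ω : Opens (E d)} {s : ℝ} {ι : Fin 2} (hι : ι ≠ 0)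
    (w : energySpace Ω s ι) : ∃ G, HasWeakGradient Ω (w : L2 d) G := by
  have h : energySpace Ω s ι = H10 Ω := if_neg hι
  have hw : (w : L2 d) ∈ H10 Ω := h ▸ w.2
  exact hw.2.imp fun _ hG => hG.1

theorem sqrt_fracForm_le_energyNorm (Ω : Opens (E d)) (s : ℝ) (ι : Fin 2) (w : L2 d) :
    √(fracForm s w w) ≤ energyNorm Ω s ι w := by
  refine Real.sqrt_le_sqrt ?_
  have hI : 0 ≤ ∫ x in (Ω : Set (E d)), ‖weakGradient Ω w x‖ ^ 2 :=
    integral_nonneg fun x => by positivity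
  have := mul_nonneg (Nat.cast_nonneg (α := ℝ) (ι : ℕ)) hI
  linarith [sq_nonneg ‖w‖]

theorem sqrt_sobolev_le_energyNorm {Ω : Opens (E d)} {s : ℝ} {ι : Fin 2} (hι : ι ≠ 0)
    {w : L2 d} (hw : w ∈ tildeH Ω s) :
    √(‖w‖ ^ 2 + ∫ x in (Ω : Set (E d)), ‖weakGradient Ω w x‖ ^ 2) ≤
      energyNorm Ω s ι w := by
  obtain rfl : ι = 1 := Fin.eq_one_of_ne_zero ι hι
  refine Real.sqrt_le_sqrt ?_
  have := fracForm_self_nonneg hw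
  simp only [Fin.val_one, Nat.cast_one, one_mul]
  linarith

/-- Both branches of the definition are bounded: a chosen extension by its defining property, the
default because it is zero. -/
theorem exists_abs_driftForm_le (Ω : Opens (E d)) (β : E d → E d) {s : ℝ} (hs : 0 < s)
    (ι : Fin 2) :
    ∃ C : ℝ, ∀ v w : energySpace Ω s ι,
      |driftForm Ω β hs ι v w| ≤ C * energyNorm Ω s ι v * energyNorm Ω s ι w := by
  by_cases h : ∃ B, IsDriftExtension Ω β hs ι B
  · rw [driftForm, dif_pos h]
    exact h.choose_spec.1
  · rw [driftForm, dif_neg h]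
    exact ⟨0, fun v w => by simp⟩

/-! ### The multiplier and its sign -/

section Multiplier

variable {Ω : Opens (E d)} {A : E d → Matrix (Fin d) (Fin d) ℝ} {c : E d → ℝ} {β : E d → E d}
  {s : ℝ} {ι : Fin 2}

theorem fullForm_add_right (hΩ : Bornology.IsBounded (Ω : Set (E d)))
    (hA : IsEllipticCoefficient Ω A) (hc : IsReactionCoefficient Ω c) (hs₀ : 0 < s) (hs₁ : s ≤ 1)
    (u v w : energySpace Ω s ι) :
    fullForm Ω A c β hs₀ ι u (v + w) = fullForm Ω A c β hs₀ ι u v + fullForm Ω A c β hs₀ ι u w := by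
  have hle := energySpace_le_tildeH (Ω := Ω) hs₀.le hs₁ ι
  have h1 := fracForm_add_right (hle u.2) (hle v.2) (hle w.2)
  have h2 : ((ι : ℕ) : ℝ) * ellipticForm Ω A c u ((v : L2 d) + (w : L2 d)) =
      (ι : ℕ) * ellipticForm Ω A c u v + (ι : ℕ) * ellipticForm Ω A c u w := by
    -- For `ι = 0` weak gradients need not exist, but the factor `ι` removes the elliptic term.
    by_cases hι : ι = 0
    · simp [hι]
    · rw [← mul_add, ← ellipticForm_add_right hΩ hA hc (exists_weakGradient_of_mem hι u)
        (exists_weakGradient_of_mem hι v) (exists_weakGradient_of_mem hι w)]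
  rw [fullForm, fullForm, fullForm, Submodule.coe_add, h1, h2, map_add]
  ring

theorem fullForm_smul_right (hΩ : Bornology.IsBounded (Ω : Set (E d)))
    (hA : IsEllipticCoefficient Ω A) (hc : IsReactionCoefficient Ω c) (hs₀ : 0 < s) (hs₁ : s ≤ 1)
    (a : ℝ) (u w : energySpace Ω s ι) :
    fullForm Ω A c β hs₀ ι u (a • w) = a * fullForm Ω A c β hs₀ ι u w := by
  have hle := energySpace_le_tildeH (Ω := Ω) hs₀.le hs₁ ι
  have h1 := fracForm_smul_right a (hle u.2) (hle w.2)
  have h2 : ((ι : ℕ) : ℝ) * ellipticForm Ω A c u (a • (w : L2 d)) =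
      a * ((ι : ℕ) * ellipticForm Ω A c u w) := by
    by_cases hι : ι = 0
    · simp [hι]
    · rw [mul_left_comm, ← ellipticForm_smul_right hΩ hA hc a (exists_weakGradient_of_mem hι u)
        (exists_weakGradient_of_mem hι w)]
  rw [fullForm, fullForm, Submodule.coe_smul, h1, h2, map_smul, smul_eq_mul]
  ring

theorem exists_abs_fullForm_le (hΩ : Bornology.IsBounded (Ω : Set (E d)))
    (hA : IsEllipticCoefficient Ω A) (hc : IsReactionCoefficient Ω c) (hs₀ : 0 < s) (hs₁ : s ≤ 1)
    (u : energySpace Ω s ι) :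
    ∃ C : ℝ, ∀ w, |fullForm Ω A c β hs₀ ι u w| ≤ C * energyNorm Ω s ι w := by
  have hle := energySpace_le_tildeH (Ω := Ω) hs₀.le hs₁ ι
  obtain ⟨C₂, hC₂⟩ := exists_abs_driftForm_le Ω β hs₀ ι
  have hell : ∃ C₁ : ℝ, ∀ w : energySpace Ω s ι,
      |(ι : ℕ) * ellipticForm Ω A c u w| ≤ C₁ * energyNorm Ω s ι w := by
    by_cases hι : ι = 0
    · exact ⟨0, fun w => by simp [hι]⟩
    · obtain ⟨C, hC, h⟩ := exists_abs_ellipticForm_le hΩ hA hc (exists_weakGradient_of_mem hι u)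
      refine ⟨C, fun w => ?_⟩
      have e : (ι : ℕ) = 1 := by rw [Fin.eq_one_of_ne_zero ι hι]; rfl
      rw [e, Nat.cast_one, one_mul]
      exact (h w (exists_weakGradient_of_mem hι w)).trans
        (mul_le_mul_of_nonneg_left (sqrt_sobolev_le_energyNorm hι (hle w.2)) hC)
  obtain ⟨C₁, hC₁⟩ := hell
  refine ⟨C₁ + C₂ * energyNorm Ω s ι u + √(fracForm s (u : L2 d) (u : L2 d)), fun w => ?_⟩
  rw [add_mul, add_mul, fullForm]
  refine (abs_add_three _ _ _).trans (add_le_add_three (hC₁ w) (hC₂ u w) ?_)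
  exact (abs_fracForm_le (hle u.2) (hle w.2)).trans
    (mul_le_mul_of_nonneg_left (sqrt_fracForm_le_energyNorm Ω s ι w) (Real.sqrt_nonneg _))

theorem exists_isMultiplier (hΩ : Bornology.IsBounded (Ω : Set (E d)))
    (hA : IsEllipticCoefficient Ω A) (hc : IsReactionCoefficient Ω c) (hs₀ : 0 < s) (hs₁ : s ≤ 1)
    (f : EnergyDual Ω s ι) (u : energySpace Ω s ι) :
    ∃ Λ : EnergyDual Ω s ι, IsMultiplier Ω A c β hs₀ ι f u Λ := by
  let a : energySpace Ω s ι →ₗ[ℝ] ℝ :=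
    { toFun := fullForm Ω A c β hs₀ ι u
      map_add' := fullForm_add_right hΩ hA hc hs₀ hs₁ u
      map_smul' := fun r w => fullForm_smul_right hΩ hA hc hs₀ hs₁ r u w }
  obtain ⟨C, hC⟩ := exists_abs_fullForm_le (β := β) hΩ hA hc hs₀ hs₁ u
  obtain ⟨C', hC'⟩ := f.2
  refine ⟨⟨a - f.1, C + C', fun w => ?_⟩, fun w => rfl⟩
  rw [add_mul]
  exact (abs_sub _ _).trans (add_le_add (hC w) (hC' w))

/-- Admissible variations of the solution: `⟨Λ, w⟩ ≥ 0` if `u + w` lies above the obstacle. -/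
theorem IsMultiplier.nonneg_of_add_mem {χ : E d → ℝ} {hs₀ : 0 < s} {f Λ : EnergyDual Ω s ι}
    {u w : energySpace Ω s ι} (hΛ : IsMultiplier Ω A c β hs₀ ι f u Λ)
    (hu : IsSolution Ω A c β hs₀ ι χ f u) (hw : u + w ∈ admissibleSet Ω s ι χ) : 0 ≤ Λ w := by
  -- The competitor is `v = u + w`, so `u - v = -w`.
  have h := hu.2 _ hw
  rw [sub_add_cancel_left] at h
  have e := hΛ (-w)
  have e' : Λ (-w) = -Λ w := map_neg Λ.1 w
  linarith

/-- The admissible set is stable under adding nonnegative functions, so every `w ≥ 0` is an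
admissible variation. -/
theorem IsMultiplier.isNonnegDual {χ : E d → ℝ} {hs₀ : 0 < s} {f Λ : EnergyDual Ω s ι}
    {u : energySpace Ω s ι} (hΛ : IsMultiplier Ω A c β hs₀ ι f u Λ)
    (hu : IsSolution Ω A c β hs₀ ι χ f u) : IsNonnegDual Λ := by
  intro w hw
  refine hΛ.nonneg_of_add_mem hu ?_
  filter_upwards [hu.1, hw, ae_restrict_of_ae (Lp.coeFn_add (u : L2 d) (w : L2 d))] with x h1 h2 h3
  have h4 : ((u + w : energySpace Ω s ι) : L2 d) x = (u : L2 d) x + (w : L2 d) x := h3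
  rw [h4]
  linarith

end Multiplier

/-! ### Vanishing off the contact set and complementarity -/

section Complementarity

variable {Ω : Opens (E d)} {s : ℝ} {ι : Fin 2}

/-- The embedding of the test functions into the energy space. -/
def testVₗ (Ω : Opens (E d)) (hs : 0 < s) (ι : Fin 2) : 𝓓(Ω, ℝ) →ₗ[ℝ] energySpace Ω s ι where
  toFun := testV hs ι
  map_add' φ ψ := Subtype.ext (MemLp.toLp_add (memLp_test φ 2 volume) (memLp_test ψ 2 volume))
  map_smul' a φ := Subtype.ext (MemLp.toLp_const_smul a (memLp_test φ 2 volume))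

theorem testV_ae (hs : 0 < s) (ι : Fin 2) (φ : 𝓓(Ω, ℝ)) :
    ((testV hs ι φ : energySpace Ω s ι) : L2 d) =ᵐ[volume] φ := testL2_ae φ

theorem IsNonnegDual.isNonnegDist {Λ : EnergyDual Ω s ι} (hΛ : IsNonnegDual Λ) (hs : 0 < s) :
    IsNonnegDist (distOfDual hs Λ) := by
  intro φ hφ
  refine hΛ _ ?_
  filter_upwards [ae_restrict_of_ae (testV_ae hs ι φ)] with x hx
  rw [hx]
  exact hφ x

theorem isNonnegDist_distOfFun {h : E d → ℝ}
    (hh : ∀ᵐ x ∂(volume.restrict (Ω : Set (E d))), 0 ≤ h x) : IsNonnegDist (distOfFun Ω h) := by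
  intro φ hφ
  refine integral_nonneg_of_ae ?_
  filter_upwards [hh] with x hx using mul_nonneg hx (hφ x)

/-- A continuous function that is nonnegative almost everywhere in an open set is nonnegative. -/
theorem nonneg_of_ae_nonneg {h : E d → ℝ} (hc : ContinuousOn h Ω)
    (hh : ∀ᵐ x ∂(volume.restrict (Ω : Set (E d))), 0 ≤ h x) : ∀ x ∈ Ω, 0 ≤ h x := by
  have hO := hc.isOpen_inter_preimage Ω.isOpen isOpen_Iio (t := Iio 0)
  have h0 : volume ((Ω : Set (E d)) ∩ h ⁻¹' Iio 0) = 0 := by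
    rw [ae_restrict_iff' Ω.isOpen.measurableSet, ae_iff] at hh
    refine measure_mono_null ?_ hh
    rintro x ⟨hx, hx'⟩ hcon
    exact (hcon hx).not_gt hx'
  -- The set where `h < 0` is open and null, and Lebesgue measure charges every nonempty open set.
  have he := hO.eq_empty_of_measure_zero h0
  intro x hx
  by_contra hlt
  exact (he ▸ (⟨hx, not_le.1 hlt⟩ : x ∈ (Ω : Set (E d)) ∩ h ⁻¹' Iio 0) : x ∈ (∅ : Set (E d)))

/-- A nonnegative distribution that vanishes where the continuous function `h ≥ 0` is positive has
zero product with `h`. -/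
theorem productIsZero_of_forall_test (T : 𝓓(Ω, ℝ) →ₗ[ℝ] ℝ) (hT : IsNonnegDist T) {h : E d → ℝ}
    (hc : ContinuousOn h Ω) (h0 : ∀ x ∈ Ω, 0 ≤ h x)
    (hz : ∀ φ : 𝓓(Ω, ℝ), (∀ x, 0 ≤ φ x) → (∀ x, φ x ≤ 1) →
      tsupport φ ⊆ {x | x ∈ Ω ∧ 0 < h x} → T φ = 0) :
    ProductIsZero T h := by
  obtain ⟨μ, hμ, hTμ⟩ := exists_measure_of_nonneg T hT
  have hO : IsOpen {x | x ∈ Ω ∧ 0 < h x} := hc.isOpen_inter_preimage Ω.isOpen isOpen_Ioi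
  -- `μ` does not charge `{h > 0}`; since `h ≥ 0` on `Ω`, this means `h = 0` holds `μ`-almost
  -- everywhere.
  have hμ0 := measure_eq_zero_of_forall_test μ hO (fun x hx => hx.1) fun φ h1 h2 h3 => by
    rw [← hTμ, hz φ h1 h2 h3]
  refine ⟨μ, hμ, hTμ, fun φ => integral_eq_zero_of_ae ?_⟩
  have hae : ∀ᵐ x : Ω ∂μ, ¬ ((x : E d) ∈ Ω ∧ 0 < h x) := by
    rw [ae_iff]
    simpa only [not_not, mem_ofPred_eq] using hμ0
  filter_upwards [hae] with x hx
  have : h x = 0 := le_antisymm (not_lt.1 fun hlt => hx ⟨x.2, hlt⟩) (h0 x x.2)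
  simp [this]

/-- Where `u` stays strictly above the obstacle it can be moved down as well as up. Thus `u - δφ` is
admissible for small `δ > 0`, which gives `-δ Λ(φ) ≥ 0` against `Λ(φ) ≥ 0`. -/
theorem IsMultiplier.eq_zero_of_tsupport_subset {A : E d → Matrix (Fin d) (Fin d) ℝ}
    {c : E d → ℝ} {β : E d → E d} {χ g : E d → ℝ} {hs₀ : 0 < s} {f Λ : EnergyDual Ω s ι}
    {u : energySpace Ω s ι} (hΛ : IsMultiplier Ω A c β hs₀ ι f u Λ)
    (hu : IsSolution Ω A c β hs₀ ι χ f u) (hg : ContinuousOn (fun x => g x - χ x) Ω)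
    (hug : ∀ᵐ x ∂(volume.restrict (Ω : Set (E d))), (u : L2 d) x = g x)
    (φ : 𝓓(Ω, ℝ)) (h0 : ∀ x, 0 ≤ φ x) (h1 : ∀ x, φ x ≤ 1)
    (hsupp : tsupport φ ⊆ {x | x ∈ Ω ∧ 0 < g x - χ x}) : distOfDual hs₀ Λ φ = 0 := by
  refine le_antisymm ?_ ((hΛ.isNonnegDual hu).isNonnegDist hs₀ φ h0)
  -- A positive lower bound of `g - χ` on the compact support of `φ`; it also exists when the
  -- support is empty.
  obtain ⟨δ, hδ, hle⟩ := φ.hasCompactSupport.isCompact.exists_forall_le'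
    (hg.mono φ.tsupport_subset) fun x hx => (hsupp hx).2
  have hw : u + testVₗ Ω hs₀ ι ((-δ) • φ) ∈ admissibleSet Ω s ι χ := by
    filter_upwards [hu.1, hug, ae_restrict_of_ae (Lp.coeFn_add (u : L2 d)
      (testVₗ Ω hs₀ ι ((-δ) • φ) : L2 d)),
      ae_restrict_of_ae (testV_ae hs₀ ι ((-δ) • φ))] with x a1 a2 a3 a4
    have a5 : ((u + testVₗ Ω hs₀ ι ((-δ) • φ) : energySpace Ω s ι) : L2 d) x =
        (u : L2 d) x + -δ * φ x := by
      refine a3.trans ?_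
      rw [Pi.add_apply]
      congr 1
    rw [a5]
    -- On the support `u = g ≥ χ + δ` and `δφ ≤ δ`; off it `u` is unchanged.
    by_cases hx : x ∈ tsupport φ
    · have b1 := hle x hx
      have b2 := mul_le_mul_of_nonneg_left (h1 x) hδ.le
      rw [a2]
      linarith
    · rw [image_eq_zero_of_notMem_tsupport hx]
      simpa using a1
  have h := hΛ.nonneg_of_add_mem hu hw
  have e : Λ (testVₗ Ω hs₀ ι ((-δ) • φ)) = -δ * distOfDual hs₀ Λ φ := by
    change Λ.1 _ = -δ * Λ.1 (testVₗ Ω hs₀ ι φ)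
    rw [map_smul, map_smul, smul_eq_mul]
  rw [e] at h
  exact nonpos_of_mul_nonneg_right h (neg_lt_zero.2 hδ)

end Complementarity

end FracObstacle

end

theorem mainTheorem5 (d : ℕ) (hd : 1 ≤ d) (Ω : TopologicalSpace.Opens (FracObstacle.E d))
    (hΩ : FracObstacle.IsBoundedLipschitzDomain Ω)
    (A : FracObstacle.E d → Matrix (Fin d) (Fin d) ℝ)
    (hA : FracObstacle.IsEllipticCoefficient Ω A)
    (c : FracObstacle.E d → ℝ) (hc : FracObstacle.IsReactionCoefficient Ω c)
    (β : FracObstacle.E d → FracObstacle.E d) (hβ : FracObstacle.IsDriftCoefficient Ω β)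
    (χ : FracObstacle.E d → ℝ) (hχ : FracObstacle.IsObstacle Ω χ)
    (s : ℝ) (hs₀ : 0 < s) (hs₁ : s < 1) (ι : Fin 2)
    (hcase : FracObstacle.IsAdmissibleCase Ω β s ι)
    (f : FracObstacle.EnergyDual Ω s ι) (u : FracObstacle.energySpace Ω s ι)
    (hu : FracObstacle.IsSolution Ω A c β hs₀ ι χ f u) :
    ∃ Λ : FracObstacle.EnergyDual Ω s ι,
      FracObstacle.IsMultiplier Ω A c β hs₀ ι f u Λ ∧
      FracObstacle.IsNonnegDual Λ ∧
      ∀ g : FracObstacle.E d → ℝ, ContinuousOn g (closure (Ω : Set (FracObstacle.E d))) →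
        (∀ᵐ x ∂(volume.restrict (Ω : Set (FracObstacle.E d))), (u : FracObstacle.L2 d) x = g x) →
        FracObstacle.IsNonnegDist (FracObstacle.distOfDual hs₀ Λ) ∧
        FracObstacle.IsNonnegDist (FracObstacle.distOfFun Ω (fun x => g x - χ x)) ∧
        FracObstacle.ProductIsZero (FracObstacle.distOfDual hs₀ Λ) (fun x => g x - χ x) := by

  obtain ⟨Λ, hΛ⟩ := FracObstacle.exists_isMultiplier (β := β) hΩ.bounded hA hc hs₀ hs₁.le f u
  refine ⟨Λ, hΛ, hΛ.isNonnegDual hu, fun g hg hug => ?_⟩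
  have hcont : ContinuousOn (fun x => g x - χ x) (Ω : Set (FracObstacle.E d)) :=
    (hg.sub hχ.1.1).mono subset_closure
  have hae : ∀ᵐ x ∂(MeasureTheory.volume.restrict (Ω : Set (FracObstacle.E d))),
      0 ≤ g x - χ x := by
    filter_upwards [hu.1, hug] with x h1 h2
    rw [← h2]
    exact sub_nonneg.2 h1
  have hnn := (hΛ.isNonnegDual hu).isNonnegDist hs₀
  exact ⟨hnn, FracObstacle.isNonnegDist_distOfFun hae,
    FracObstacle.productIsZero_of_forall_test (Λ.1 ∘ₗ FracObstacle.testVₗ Ω hs₀ ι) hnn hcont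
      (FracObstacle.nonneg_of_ae_nonneg hcont hae)
      (hΛ.eq_zero_of_tsupport_subset hu hcont hug)⟩
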